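/- Let $N\ge 2$, let $\Omega\subset\mathbb{R}^N$ be a bounded Lipschitz domain (nonempty, open, connected, and locally near each boundary point the epigraph of a Lipschitz function in suitable orthonormal coordinates), and let $0<s<1<p<N/s$. For measurable $u:\mathbb{R}^N\to\mathbb{R}$ put $$[u]_{s,p}=\Big(\int_{\mathbb{R}^N}\int_{\mathbb{R}^N}\frac{|u(x)-u(y)|^p}{|x-y|^{N+sp}}\,dx\,dy\Big)^{1/p},$$ let $|\cdot|_r$ be the norm of $L^r(\Omega)$, and let $W_0^{s,p}(\Omega)$ be the closure of $C_0^\infty(\Omega)$ in the norm $[u]_{s,p}+|u|_p$, its elements being extended by $0$ to $\mathbb{R}^N$ and identified when equal almost everywhere. There is a unique $\phi\in W_0^{s,p}(\Omega)$, the $(s,p)$-torsion function $\phi=\phi_p^s$ of $\Omega$, such that $$\int_{\mathbb{R}^N}\int_{\mathbb{R}^N}\frac{|\phi(x)-\phi(y)|^{p-2}(\phi(x)-\phi(y))(v(x)-v(y))}{|x-y|^{N+sp}}\,dx\,dy=\int_\Omega v\,dx\qquad\text{for all } v\in W_0^{s,p}(\Omega).$$ It satisfies $\phi_p^s\ge 0$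 almost everywhere and $0<|\phi_p^s|_1<\infty$, and $$\frac{1}{|\phi_p^s|_1^{p-1}}=\min\Big\{[v]_{s,p}^p : v\in W_0^{s,p}(\Omega),\ |v|_1=1\Big\}=\Big[\frac{\phi_p^s}{|\phi_p^s|_1}\Big]_{s,p}^p .$$ Moreover, $\phi_p^s/|\phi_p^s|_1$ is the only nonnegative function in $W_0^{s,p}(\Omega)$ with $|v|_1=1$ at which this minimum is attained. -/

import Mathlib

open MeasureTheory Set
open scoped ENNReal NNReal ContDiff

noncomputable section

/-- A bounded Lipschitz domain of `ℝ^N`: a bounded, connected, nonempty open set which near each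
of its boundary points is, in the direction of some unit vector `ν`, the strict epigraph of a
Lipschitz function of the component orthogonal to `ν`. -/
structure IsBoundedLipschitzDomain {N : ℕ} (Ω : Set (EuclideanSpace ℝ (Fin N))) : Prop where
  isOpen : IsOpen Ω
  isConnected : IsConnected Ω
  isBounded : Bornology.IsBounded Ω
  lipschitz_boundary : ∀ x ∈ frontier Ω,
    ∃ (ν : EuclideanSpace ℝ (Fin N)) (g : EuclideanSpace ℝ (Fin N) → ℝ) (K : ℝ≥0) (r : ℝ),
      ‖ν‖ = 1 ∧ LipschitzWith K g ∧ 0 < r ∧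
        ∀ y ∈ Metric.ball x r, (y ∈ Ω ↔ g (y - inner ℝ ν y • ν) < inner ℝ ν y)

/-- The Gagliardo seminorm `[u]_{s,p}` on `ℝ^N`, with values in `[0, ∞]`. -/
def gagliardoSeminorm {N : ℕ} (s p : ℝ) (u : EuclideanSpace ℝ (Fin N) → ℝ) : ℝ≥0∞ :=
  (∫⁻ z : EuclideanSpace ℝ (Fin N) × EuclideanSpace ℝ (Fin N),
    ENNReal.ofReal (|u z.1 - u z.2| ^ p / ‖z.1 - z.2‖ ^ ((N : ℝ) + s * p))) ^ (1 / p)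

/-- The norm `|u|_r` of `L^r(Ω)`, with values in `[0, ∞]`. -/
def normL {N : ℕ} (r : ℝ) (Ω : Set (EuclideanSpace ℝ (Fin N)))
    (u : EuclideanSpace ℝ (Fin N) → ℝ) : ℝ≥0∞ :=
  eLpNorm u (ENNReal.ofReal r) (volume.restrict Ω)

/-- `C_0^∞(Ω)`: smooth functions with compact support contained in `Ω`. -/
def IsTestFunction {N : ℕ} (Ω : Set (EuclideanSpace ℝ (Fin N)))
    (η : EuclideanSpace ℝ (Fin N) → ℝ) : Prop :=
  ContDiff ℝ ∞ η ∧ HasCompactSupport η ∧ tsupport η ⊆ Ω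

/-- Membership in `W_0^{s,p}(Ω)`, the closure of `C_0^∞(Ω)` for the norm `[u]_{s,p} + |u|_p`.
Its elements are regarded as functions on `ℝ^N` which vanish (a.e.) outside `Ω`; functions that
agree almost everywhere represent the same element. -/
structure MemW0 {N : ℕ} (s p : ℝ) (Ω : Set (EuclideanSpace ℝ (Fin N)))
    (u : EuclideanSpace ℝ (Fin N) → ℝ) : Prop where
  aestronglyMeasurable : AEStronglyMeasurable u volume
  ae_eq_zero : ∀ᵐ x ∂volume, x ∉ Ω → u x = 0
  approx : ∀ ε : ℝ≥0∞, 0 < ε → ∃ η : EuclideanSpace ℝ (Fin N) → ℝ, IsTestFunction Ω η ∧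
    gagliardoSeminorm s p (fun x => u x - η x) + normL p Ω (fun x => u x - η x) < ε

/-- The pairing `⟨(-Δ)_p^s u, v⟩`. -/
def fracPLaplacePairing {N : ℕ} (s p : ℝ) (u v : EuclideanSpace ℝ (Fin N) → ℝ) : ℝ :=
  ∫ z : EuclideanSpace ℝ (Fin N) × EuclideanSpace ℝ (Fin N),
    |u z.1 - u z.2| ^ (p - 2) * (u z.1 - u z.2) * (v z.1 - v z.2) /
      ‖z.1 - z.2‖ ^ ((N : ℝ) + s * p)

/-- `u` is a weak solution of `(-Δ)_p^s u = f` in `Ω`, `u = 0` in `ℝ^N ∖ Ω`. -/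
def IsWeakSolution {N : ℕ} (s p : ℝ) (Ω : Set (EuclideanSpace ℝ (Fin N)))
    (f u : EuclideanSpace ℝ (Fin N) → ℝ) : Prop :=
  MemW0 s p Ω u ∧ ∀ v : EuclideanSpace ℝ (Fin N) → ℝ, MemW0 s p Ω v →
    fracPLaplacePairing s p u v = ∫ x in Ω, f x * v x

/-- `φ` is (a representative of) the `(s,p)`-torsion function of `Ω`. -/
def IsTorsionFunction {N : ℕ} (s p : ℝ) (Ω : Set (EuclideanSpace ℝ (Fin N)))
    (φ : EuclideanSpace ℝ (Fin N) → ℝ) : Prop :=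
  IsWeakSolution s p Ω (fun _ => 1) φ

/-- The normalization `φ / |φ|_1`. -/
def normalizeL1 {N : ℕ} (Ω : Set (EuclideanSpace ℝ (Fin N)))
    (φ : EuclideanSpace ℝ (Fin N) → ℝ) : EuclideanSpace ℝ (Fin N) → ℝ :=
  fun x => φ x / (normL 1 Ω φ).toReal

end

/-! ### Convexity of `|·| ^ p` -/

/-! The torsion equation is the Euler–Lagrange equation of the strictly convex energy `J(u) = [u]^p
/ p - ∫_Ω u` on `W_0^{s,p}(Ω)`, so its solutions are exactly the minimizers of `J`. Testing the
equation with `φ` gives `[φ]^p = ∫_Ω φ = A`, hence `J(φ) = A / p - A`. If `|v|_1 = 1`, comparing `φ`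
with `A v` in the inequality `J(φ) ≤ [w]^p / p - ∫_Ω |w|` gives `A ≤ A^p [v]^p`, that is `[v]^p ≥
A^(1-p)`, and `v = φ / A` gives equality. A nonnegative `v` with equality makes `A v` a minimizer of
`J`, so `A v = φ`.

The map `u ↦ fracQuotient s p u` turns the seminorm into an `L^p` norm on pairs of points, so
convexity facts about `|·|^p` on the line can simply be integrated. The tangent-line inequality
(`abs_rpow_tangent_lt`) shows that weak solutions minimize `J` and that the minimizer is unique. The
uniform convexity estimate (`exists_abs_sub_rpow_le_midpoint`) makes minimizing sequences Cauchy;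
with the Poincaré inequality and completeness this yields existence without weak compactness.

The inequality with `|w|` (`IsTorsionFunction.torsionEnergy_le_abs`) is proved without showing that
`|w|` lies in the closure of the test functions: for a test function `η`, `|η|` is smoothed to `√(η²
+ δ²) - δ`, then `δ → 0`, and density concludes. Nonnegativity of `φ` is the case `w = φ`. -/

theorem strictConvexOn_abs_rpow {p : ℝ} (hp : 1 < p) :
    StrictConvexOn ℝ univ fun x : ℝ => |x| ^ p := by
  refine ⟨convex_univ, fun x _ y _ hxy a b ha hb hab => ?_⟩
  simp only [smul_eq_mul]
  have htri : |a * x + b * y| ≤ a * |x| + b * |y| := by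
    refine (abs_add_le _ _).trans (le_of_eq ?_)
    rw [abs_mul, abs_mul, abs_of_pos ha, abs_of_pos hb]
  -- If `|x| = |y|` then `y = -x`, and the strictness comes from cancellation inside the absolute
  -- value; otherwise it comes from strict convexity of the power on `[0, ∞)`.
  rcases eq_or_ne |x| |y| with h | h
  · have hyx : y = -x := by
      rcases abs_eq_abs.1 h with h | h
      · exact absurd h hxy
      · linarith
    subst hyx
    have hx : 0 < |x| := abs_pos.2 fun h0 => hxy (by simp [h0])
    have hlt : |a * x + b * -x| < |x| := by
      rw [show a * x + b * -x = (a - b) * x by ring, abs_mul]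
      have : |a - b| < 1 := abs_lt.2 ⟨by linarith, by linarith⟩
      nlinarith
    calc |a * x + b * -x| ^ p < |x| ^ p :=
          Real.rpow_lt_rpow (abs_nonneg _) hlt (by linarith)
      _ = a * |x| ^ p + b * |-x| ^ p := by rw [abs_neg, ← add_mul, hab, one_mul]
  · calc |a * x + b * y| ^ p ≤ (a * |x| + b * |y|) ^ p :=
          Real.rpow_le_rpow (abs_nonneg _) htri (by linarith)
      _ < a * |x| ^ p + b * |y| ^ p := by
          simpa using (strictConvexOn_rpow hp).2 (abs_nonneg x) (abs_nonneg y) h ha hb hab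

/-- By strict convexity the graph lies above the tangent at `a`, whose slope is `p |a|^(p-2) a`. The
gap, integrated over difference quotients, measures the excess of energy over the torsion function.
-/
theorem abs_rpow_tangent_lt {p : ℝ} (hp : 1 < p) {a b : ℝ} (hab : a ≠ b) :
    |a| ^ p + p * (|a| ^ (p - 2) * a * (b - a)) < |b| ^ p := by
  have hd := hasDerivAt_abs_rpow a hp
  rcases lt_or_gt_of_ne hab with h | h
  · have := (strictConvexOn_abs_rpow hp).lt_slope_of_hasDerivAt (mem_univ a) (mem_univ b) h hd
    rw [slope_def_field, lt_div_iff₀ (by linarith)] at this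
    nlinarith
  · have := (strictConvexOn_abs_rpow hp).slope_lt_of_hasDerivAt (mem_univ b) (mem_univ a) h hd
    rw [slope_def_field, div_lt_iff₀ (by linarith)] at this
    nlinarith

theorem abs_rpow_tangent_le {p : ℝ} (hp : 1 < p) (a b : ℝ) :
    |a| ^ p + p * (|a| ^ (p - 2) * a * (b - a)) ≤ |b| ^ p := by
  rcases eq_or_ne a b with rfl | h
  · simp
  · exact (abs_rpow_tangent_lt hp h).le

theorem abs_midpoint_rpow_le {p : ℝ} (hp : 1 < p) (a b : ℝ) :
    |(a + b) / 2| ^ p ≤ (|a| ^ p + |b| ^ p) / 2 := by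
  have := (strictConvexOn_abs_rpow hp).convexOn.2 (mem_univ a) (mem_univ b)
    (show (0 : ℝ) ≤ 1 / 2 by norm_num) (show (0 : ℝ) ≤ 1 / 2 by norm_num) (by norm_num)
  simp only [smul_eq_mul] at this
  rw [show (a + b) / 2 = 1 / 2 * a + 1 / 2 * b by ring]
  linarith

theorem abs_midpoint_rpow_lt {p : ℝ} (hp : 1 < p) {a b : ℝ} (hab : a ≠ b) :
    |(a + b) / 2| ^ p < (|a| ^ p + |b| ^ p) / 2 := by
  have := (strictConvexOn_abs_rpow hp).2 (mem_univ a) (mem_univ b) hab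
    (show (0 : ℝ) < 1 / 2 by norm_num) (show (0 : ℝ) < 1 / 2 by norm_num) (by norm_num)
  simp only [smul_eq_mul] at this
  rw [show (a + b) / 2 = 1 / 2 * a + 1 / 2 * b by ring]
  linarith

/-- A quantitative form of the uniform convexity of `|·| ^ p`: the `p`-th power of the distance is
controlled by the midpoint convexity defect, up to a small multiple of the `p`-th powers. -/
theorem exists_abs_sub_rpow_le_midpoint {p : ℝ} (hp : 1 < p) {ε : ℝ} (hε : 0 < ε) :
    ∃ C : ℝ, 0 ≤ C ∧ ∀ a b : ℝ, |a - b| ^ p ≤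
      ε * (|a| ^ p + |b| ^ p) + C * ((|a| ^ p + |b| ^ p) / 2 - |(a + b) / 2| ^ p) := by
  have hp0 : 0 < p := by linarith
  have hpne : p ≠ 0 := hp0.ne'
  have hcont : Continuous fun x : ℝ => |x| ^ p :=
    continuous_abs.rpow_const fun _ => Or.inr hp0.le
  -- Both sides are homogeneous of degree `p`, so pairs may be normalized to `|a|^p + |b|^p = 1`.
  -- Those with `|a - b|^p ≥ ε` form a compact set on which the defect `g` has a positive minimum
  -- `m`.
  set K : Set (ℝ × ℝ) := {q | |q.1| ^ p + |q.2| ^ p = 1 ∧ ε ≤ |q.1 - q.2| ^ p} with hK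
  set g : ℝ × ℝ → ℝ := fun q => (|q.1| ^ p + |q.2| ^ p) / 2 - |(q.1 + q.2) / 2| ^ p with hg
  have h1 : Continuous fun q : ℝ × ℝ => |q.1| ^ p := hcont.comp continuous_fst
  have h2 : Continuous fun q : ℝ × ℝ => |q.2| ^ p := hcont.comp continuous_snd
  have h3 : Continuous fun q : ℝ × ℝ => |q.1 - q.2| ^ p :=
    hcont.comp (continuous_fst.sub continuous_snd)
  have hgc : Continuous g :=
    ((h1.add h2).div_const 2).sub (hcont.comp ((continuous_fst.add continuous_snd).div_const 2))
  have hle1 : ∀ x : ℝ, |x| ^ p ≤ 1 → |x| ≤ 1 := fun x hx => by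
    by_contra h
    exact absurd hx (not_le.2 (Real.one_lt_rpow (not_le.1 h) hp0))
  have hKc : IsCompact K := by
    refine Metric.isCompact_of_isClosed_isBounded ?_ ?_
    · exact (isClosed_eq (h1.add h2) continuous_const).inter (isClosed_le continuous_const h3)
    · refine Metric.isBounded_closedBall (x := ((0 : ℝ), (0 : ℝ))) (r := 1) |>.subset ?_
      rintro ⟨x, y⟩ ⟨hxy, -⟩
      have hx : 0 ≤ |x| ^ p := by positivity
      have hy : 0 ≤ |y| ^ p := by positivity
      simp only at hxy
      rw [Metric.mem_closedBall, Prod.dist_eq]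
      simp only [Real.dist_eq, sub_zero]
      exact max_le (hle1 x (by linarith)) (hle1 y (by linarith))
  obtain ⟨m, hm, hmK⟩ : ∃ m : ℝ, 0 < m ∧ ∀ q ∈ K, m ≤ g q := by
    rcases K.eq_empty_or_nonempty with he | hne
    · exact ⟨1, one_pos, by simp [he]⟩
    · obtain ⟨q, hq, hmin⟩ := hKc.exists_isMinOn hne hgc.continuousOn
      refine ⟨g q, ?_, fun r hr => hmin hr⟩
      have : q.1 ≠ q.2 := by
        intro h
        have := hq.2
        rw [h, sub_self, abs_zero, Real.zero_rpow hpne] at this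
        linarith
      exact sub_pos.2 (abs_midpoint_rpow_lt hp this)
  -- For far pairs `|a - b|^p ≤ 2^p S` while the defect is at least `m S`; this dictates `2^p / m`.
  -- Near pairs are covered by the `ε` term alone.
  refine ⟨2 ^ p / m, by positivity, fun a b => ?_⟩
  set S := |a| ^ p + |b| ^ p with hS
  have hSn : 0 ≤ S := by positivity
  have hdef : 0 ≤ S / 2 - |(a + b) / 2| ^ p := sub_nonneg.2 (abs_midpoint_rpow_le hp a b)
  rcases hSn.eq_or_lt with h0 | hpos
  · have ha : |a| ^ p = 0 := by
      have : 0 ≤ |a| ^ p := by positivity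
      have : 0 ≤ |b| ^ p := by positivity
      linarith
    have hb : |b| ^ p = 0 := by linarith
    have ha' : a = 0 := by simpa using (Real.rpow_eq_zero (abs_nonneg a) hpne).1 ha
    have hb' : b = 0 := by simpa using (Real.rpow_eq_zero (abs_nonneg b) hpne).1 hb
    rw [ha', hb', sub_zero, abs_zero, Real.zero_rpow hpne]
    exact add_nonneg (mul_nonneg hε.le hSn) (mul_nonneg (by positivity) (by
      simpa [ha', hb'] using hdef))
  set t := S ^ (1 / p) with ht
  have htpos : 0 < t := Real.rpow_pos_of_pos hpos _
  have htp : t ^ p = S := by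
    rw [ht, ← Real.rpow_mul hSn, one_div, inv_mul_cancel₀ hpne, Real.rpow_one]
  have hscale : ∀ x : ℝ, |x / t| ^ p = |x| ^ p / S := fun x => by
    rw [abs_div, abs_of_pos htpos, Real.div_rpow (abs_nonneg _) htpos.le, htp]
  by_cases hfar : ε ≤ |a / t - b / t| ^ p
  · have hmem : (a / t, b / t) ∈ K := by
      refine ⟨?_, hfar⟩
      simp only
      rw [hscale, hscale, ← add_div, div_self hpos.ne']
    have := hmK _ hmem
    simp only [hg] at this
    rw [show (a / t + b / t) / 2 = ((a + b) / 2) / t by ring, hscale, hscale, hscale,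
      show (|a| ^ p / S + |b| ^ p / S) / 2 - |(a + b) / 2| ^ p / S
        = (S / 2 - |(a + b) / 2| ^ p) / S by rw [hS]; ring, le_div_iff₀ hpos] at this
    have hub : |a - b| ^ p ≤ 2 ^ p * S := by
      have h1 := abs_midpoint_rpow_le hp a (-b)
      rw [← sub_eq_add_neg, abs_div, abs_two, Real.div_rpow (abs_nonneg _) (by norm_num), abs_neg,
        div_le_iff₀ (by positivity)] at h1
      have : 0 ≤ (2 : ℝ) ^ p := by positivity
      nlinarith
    have h4 : 2 ^ p * S ≤ 2 ^ p / m * (S / 2 - |(a + b) / 2| ^ p) := by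
      rw [div_mul_eq_mul_div, le_div_iff₀ hm, mul_assoc]
      exact mul_le_mul_of_nonneg_left (by linarith) (by positivity)
    have : 0 ≤ ε * S := by positivity
    linarith
  · push Not at hfar
    rw [← sub_div, hscale, div_lt_iff₀ hpos] at hfar
    have : 0 ≤ 2 ^ p / m * (S / 2 - |(a + b) / 2| ^ p) := by positivity
    linarith

theorem abs_rpow_sub_two_mul_self {p : ℝ} (hp : 1 < p) (a : ℝ) :
    |(|a| ^ (p - 2) * a)| = |a| ^ (p - 1) := by
  rcases eq_or_ne a 0 with rfl | h
  · simp [Real.zero_rpow (by linarith : p - 1 ≠ 0)]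
  · have h' : 0 < |a| := abs_pos.2 h
    rw [abs_mul, abs_of_nonneg (by positivity), ← Real.rpow_add_one h'.ne']
    congr 1; ring

/-- A pointwise substitute for Hölder: with `c = |f| + |g|` it supplies one integrable majorant for
the pairing and for the derivative of the energy. -/
theorem abs_rpow_sub_two_mul_self_mul_le {p : ℝ} (hp : 1 < p) {a b c : ℝ} (ha : |a| ≤ c)
    (hb : |b| ≤ c) : |(|a| ^ (p - 2) * a * b)| ≤ c ^ p := by
  have hc : 0 ≤ c := (abs_nonneg a).trans ha
  rw [abs_mul, abs_rpow_sub_two_mul_self hp]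
  rcases hc.eq_or_lt with h | h
  · have : |b| = 0 := le_antisymm (h ▸ hb) (abs_nonneg _)
    rw [this, mul_zero]; positivity
  · calc |a| ^ (p - 1) * |b| ≤ c ^ (p - 1) * c :=
          mul_le_mul (Real.rpow_le_rpow (abs_nonneg _) ha (by linarith)) hb (abs_nonneg _)
            (by positivity)
      _ = c ^ p := by rw [← Real.rpow_add_one h.ne']; congr 1; ring

/-- Since `p > 1`, a linear term is absorbed by any positive multiple of `t ^ p`; this is the source
of coercivity. -/
theorem exists_mul_le_mul_rpow_add {p : ℝ} (hp : 1 < p) (C : ℝ) {ε : ℝ} (hε : 0 < ε) :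
    ∃ B : ℝ, ∀ t : ℝ, 0 ≤ t → C * t ≤ ε * t ^ p + B := by
  -- beyond `R`, the superlinear term dominates
  set R := (|C| / ε) ^ (1 / (p - 1)) with hR
  have hR0 : 0 ≤ R := by positivity
  refine ⟨|C| * R, fun t ht => ?_⟩
  have hCt : C * t ≤ |C| * t := mul_le_mul_of_nonneg_right (le_abs_self C) ht
  rcases le_total t R with h | h
  · have : |C| * t ≤ |C| * R := mul_le_mul_of_nonneg_left h (abs_nonneg _)
    have : 0 ≤ ε * t ^ p := by positivity
    linarith
  · have h1 : |C| / ε ≤ t ^ (p - 1) := by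
      calc |C| / ε = R ^ (p - 1) := by
            rw [hR, ← Real.rpow_mul (by positivity), one_div,
              inv_mul_cancel₀ (by linarith : p - 1 ≠ 0), Real.rpow_one]
        _ ≤ t ^ (p - 1) := Real.rpow_le_rpow hR0 h (by linarith)
    rw [div_le_iff₀ hε] at h1
    have h2 : t ^ (p - 1) * t = t ^ p := by
      rcases ht.eq_or_lt with h0 | h0
      · rw [← h0, mul_zero, Real.zero_rpow (by linarith)]
      · rw [← Real.rpow_add_one h0.ne']; congr 1; ring
    have : |C| * t ≤ ε * t ^ p := by
      calc |C| * t ≤ t ^ (p - 1) * ε * t := mul_le_mul_of_nonneg_right h1 ht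
        _ = ε * t ^ p := by rw [← h2]; ring
    have : 0 ≤ |C| * R := by positivity
    linarith

/-! ### The fractional difference quotient -/

section Quotient

variable {N : ℕ}

local notation "𝔼" => EuclideanSpace ℝ (Fin N)

/-- The fractional difference quotient `(u x - u y) / |x - y| ^ (N / p + s)`, whose `L^p` norm is the
Gagliardo seminorm. -/
noncomputable def fracQuotient (s p : ℝ) (u : EuclideanSpace ℝ (Fin N) → ℝ)
    (z : EuclideanSpace ℝ (Fin N) × EuclideanSpace ℝ (Fin N)) : ℝ :=
  (u z.1 - u z.2) / ‖z.1 - z.2‖ ^ (((N : ℝ) + s * p) / p)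

theorem fracQuotient_add (s p : ℝ) (u v : 𝔼 → ℝ) :
    fracQuotient s p (fun x => u x + v x) =
      fun z => fracQuotient s p u z + fracQuotient s p v z := by
  ext z; simp only [fracQuotient]; ring

theorem fracQuotient_sub (s p : ℝ) (u v : 𝔼 → ℝ) :
    fracQuotient s p (fun x => u x - v x) =
      fun z => fracQuotient s p u z - fracQuotient s p v z := by
  ext z; simp only [fracQuotient]; ring

theorem fracQuotient_const_mul (s p c : ℝ) (u : 𝔼 → ℝ) :
    fracQuotient s p (fun x => c * u x) = fun z => c * fracQuotient s p u z := by
  ext z; simp only [fracQuotient]; ring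

theorem abs_fracQuotient_rpow {s p : ℝ} (hp : 0 < p) (u : 𝔼 → ℝ) (z : 𝔼 × 𝔼) :
    |fracQuotient s p u z| ^ p = |u z.1 - u z.2| ^ p / ‖z.1 - z.2‖ ^ ((N : ℝ) + s * p) := by
  have hn : 0 ≤ ‖z.1 - z.2‖ ^ (((N : ℝ) + s * p) / p) := by positivity
  rw [fracQuotient, abs_div, abs_of_nonneg hn, Real.div_rpow (abs_nonneg _) hn,
    ← Real.rpow_mul (norm_nonneg _), div_mul_cancel₀ _ hp.ne']

theorem enorm_fracQuotient_rpow {s p : ℝ} (hp : 0 < p) (u : 𝔼 → ℝ) (z : 𝔼 × 𝔼) :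
    ‖fracQuotient s p u z‖ₑ ^ p =
      ENNReal.ofReal (|u z.1 - u z.2| ^ p / ‖z.1 - z.2‖ ^ ((N : ℝ) + s * p)) := by
  rw [← abs_fracQuotient_rpow hp, Real.enorm_eq_ofReal_abs,
    ENNReal.ofReal_rpow_of_nonneg (abs_nonneg _) hp.le]

theorem eLpNorm_ofReal_eq {α : Type*} [MeasurableSpace α] {μ : Measure α} {p : ℝ} (hp : 0 < p)
    (f : α → ℝ) : eLpNorm f (ENNReal.ofReal p) μ = (∫⁻ x, ‖f x‖ₑ ^ p ∂μ) ^ (1 / p) := by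
  rw [eLpNorm_eq_lintegral_rpow_enorm_toReal (by simpa using hp) ENNReal.ofReal_ne_top,
    ENNReal.toReal_ofReal hp.le]

theorem gagliardoSeminorm_eq_eLpNorm {s p : ℝ} (hp : 0 < p) (u : 𝔼 → ℝ) :
    gagliardoSeminorm s p u = eLpNorm (fracQuotient s p u) (ENNReal.ofReal p) volume := by
  simp only [eLpNorm_ofReal_eq hp, gagliardoSeminorm, enorm_fracQuotient_rpow hp]

/-- With `k = |x - y|^((N + s p) / p)`, the kernel denominator splits as `k^(p-2) · k · k`, one part
for each factor. The pairing becomes the `L^p` duality form of the difference quotients; on the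
diagonal both integrands vanish. -/
theorem fracPLaplacePairing_eq {s p : ℝ} (hp : 0 < p) (u v : 𝔼 → ℝ) :
    fracPLaplacePairing s p u v =
      ∫ z, |fracQuotient s p u z| ^ (p - 2) * fracQuotient s p u z * fracQuotient s p v z := by
  refine integral_congr_ae (Filter.Eventually.of_forall fun z => ?_)
  simp only [fracQuotient]
  rcases eq_or_ne z.1 z.2 with h | h
  · simp [h]
  have hz : 0 < ‖z.1 - z.2‖ := norm_pos_iff.2 (sub_ne_zero.2 h)
  set k := ‖z.1 - z.2‖ ^ (((N : ℝ) + s * p) / p) with hk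
  have hkpos : 0 < k := Real.rpow_pos_of_pos hz _
  have hkp : ‖z.1 - z.2‖ ^ ((N : ℝ) + s * p) = k ^ (p - 2) * k * k := by
    rw [← Real.rpow_add_one hkpos.ne', ← Real.rpow_add_one hkpos.ne', hk, ← Real.rpow_mul hz.le]
    congr 1; field_simp; ring
  rw [hkp, abs_div, abs_of_pos hkpos, Real.div_rpow (abs_nonneg _) hkpos.le]
  have : 0 < k ^ (p - 2) := by positivity
  field_simp

theorem quasiMeasurePreserving_fst_volume :
    Measure.QuasiMeasurePreserving (Prod.fst : 𝔼 × 𝔼 → 𝔼) volume volume :=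
  Measure.quasiMeasurePreserving_fst

theorem quasiMeasurePreserving_snd_volume :
    Measure.QuasiMeasurePreserving (Prod.snd : 𝔼 × 𝔼 → 𝔼) volume volume :=
  Measure.quasiMeasurePreserving_snd

theorem aestronglyMeasurable_fracQuotient (s p : ℝ) {u : 𝔼 → ℝ}
    (hu : AEStronglyMeasurable u volume) :
    AEStronglyMeasurable (fracQuotient s p u) volume := by
  have h1 := hu.comp_quasiMeasurePreserving quasiMeasurePreserving_fst_volume
  have h2 := hu.comp_quasiMeasurePreserving quasiMeasurePreserving_snd_volume
  have h3 : Measurable fun z : 𝔼 × 𝔼 => ‖z.1 - z.2‖ ^ (((N : ℝ) + s * p) / p) := by fun_prop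
  exact ((h1.sub h2).aemeasurable.div h3.aemeasurable).aestronglyMeasurable

/-! ### Finiteness of the seminorm on compactly supported Lipschitz functions -/

/-- In polar coordinates the integrand is `r^(p - s p - 1)` near `0`, integrable because `s < 1`,
and `r^(-s p - 1)` at infinity, integrable because `s > 0`. -/
theorem integrable_fracKernel [NeZero N] {s p : ℝ} (hs0 : 0 < s) (hs1 : s < 1) (hp : 0 < p) :
    Integrable (fun h : 𝔼 => if ‖h‖ ≤ 1 then ‖h‖ ^ (p - ((N : ℝ) + s * p))
      else ‖h‖ ^ (-((N : ℝ) + s * p))) volume := by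
  have : Nonempty (Fin N) := ⟨⟨0, Nat.pos_of_ne_zero (NeZero.ne N)⟩⟩
  have hN : 1 ≤ N := Nat.one_le_iff_ne_zero.2 (NeZero.ne N)
  rw [integrable_fun_norm_addHaar volume
    (f := fun r => if r ≤ 1 then r ^ (p - ((N : ℝ) + s * p)) else r ^ (-((N : ℝ) + s * p)))]
  rw [finrank_euclideanSpace, Fintype.card_fin, ← Ioc_union_Ioi_eq_Ioi (zero_le_one' ℝ)]
  have hpow : ∀ (r a : ℝ), 0 < r → r ^ (N - 1) * r ^ a = r ^ ((N : ℝ) - 1 + a) := fun r a hr => by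
    rw [← Real.rpow_natCast, ← Real.rpow_add hr, Nat.cast_sub hN, Nat.cast_one]
  have hsp : s * p < p := by nlinarith
  have hsp0 : 0 < s * p := by positivity
  refine IntegrableOn.union ?_ ?_
  · have h1 : IntegrableOn (fun r : ℝ => r ^ ((N : ℝ) - 1 + (p - ((N : ℝ) + s * p)))) (Ioc 0 1) :=
      (integrableOn_Ioc_iff_integrableOn_Ioo).2
        ((intervalIntegral.integrableOn_Ioo_rpow_iff one_pos).2 (by linarith))
    refine h1.congr_fun (fun r hr => ?_) measurableSet_Ioc
    simp only [hr.2, if_true, smul_eq_mul]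
    exact (hpow r _ hr.1).symm
  · have h1 : IntegrableOn (fun r : ℝ => r ^ ((N : ℝ) - 1 + (-((N : ℝ) + s * p)))) (Ioi 1) :=
      integrableOn_Ioi_rpow_of_lt (by linarith) one_pos
    refine h1.congr_fun (fun r hr => ?_) measurableSet_Ioi
    simp only [not_le.2 (mem_Ioi.1 hr), if_false, smul_eq_mul]
    exact (hpow r _ (one_pos.trans hr)).symm

/-- The Lipschitz bound controls the integrand for `|x - y| ≤ 1` and the sup bound controls it
beyond, both by `A k(x - y)`. Since the integrand vanishes unless `x` or `y` lies in the support,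
the double integral is at most twice `|K| ∫ A k`. -/
theorem gagliardoSeminorm_lt_top_of_lipschitz [NeZero N] {s p : ℝ} (hs0 : 0 < s) (hs1 : s < 1)
    (hp : 0 < p) {η : 𝔼 → ℝ} {L : ℝ≥0} (hL : LipschitzWith L η) (hη : HasCompactSupport η) :
    gagliardoSeminorm s p η < ⊤ := by
  refine ENNReal.rpow_lt_top_of_nonneg (by positivity) (ne_of_lt ?_)
  obtain ⟨M, hM⟩ := hL.continuous.bounded_above_of_compact_support hη
  have hM0 : 0 ≤ M := (norm_nonneg _).trans (hM 0)
  set k : 𝔼 → ℝ := fun h => if ‖h‖ ≤ 1 then ‖h‖ ^ (p - ((N : ℝ) + s * p))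
      else ‖h‖ ^ (-((N : ℝ) + s * p)) with hk
  have hkint : Integrable k volume := integrable_fracKernel hs0 hs1 hp
  have hkm : Measurable k := by
    refine Measurable.ite (measurableSet_le measurable_norm measurable_const) ?_ ?_ <;> fun_prop
  have hk0 : ∀ h, 0 ≤ k h := fun h => by simp only [hk]; split_ifs <;> positivity
  set A : ℝ := (L : ℝ) ^ p + (2 * M) ^ p with hA
  have hA0 : 0 ≤ A := by positivity
  set K := tsupport η with hKdef
  have hKm : MeasurableSet K := (isClosed_tsupport η).measurableSet
  have hKfin : volume K < ⊤ := IsCompact.measure_lt_top hη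
  set f : 𝔼 × 𝔼 → ℝ≥0∞ :=
    fun z => K.indicator (fun _ => (1 : ℝ≥0∞)) z.1 * ENNReal.ofReal (A * k (z.1 - z.2)) with hf
  have hfm : Measurable f :=
    ((measurable_const.indicator hKm).comp measurable_fst).mul
      ((hkm.comp (measurable_fst.sub measurable_snd)).const_mul A).ennreal_ofReal
  have hksymm : ∀ h, k (-h) = k h := fun h => by simp only [hk, norm_neg]
  have hI : ∫⁻ h : 𝔼, ENNReal.ofReal (A * k h) < ⊤ := by
    have := (hkint.const_mul A).lintegral_lt_top
    exact this
  have hffin : ∫⁻ z, f z < ⊤ := by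
    rw [Measure.volume_eq_prod, lintegral_prod _ hfm.aemeasurable]
    simp only [hf]
    have : ∀ x : 𝔼, ∫⁻ y : 𝔼, K.indicator (fun _ => (1 : ℝ≥0∞)) x * ENNReal.ofReal (A * k (x - y))
        = K.indicator (fun _ => (1 : ℝ≥0∞)) x * ∫⁻ h : 𝔼, ENNReal.ofReal (A * k h) := fun x => by
      rw [lintegral_const_mul _ (by fun_prop)]
      rw [lintegral_sub_left_eq_self (fun h => ENNReal.ofReal (A * k h)) x]
    simp only [this]
    rw [lintegral_mul_const _ (measurable_const.indicator hKm), lintegral_indicator hKm]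
    simp only [lintegral_const, one_mul, Measure.restrict_apply, MeasurableSet.univ, univ_inter]
    exact ENNReal.mul_lt_top hKfin hI
  have hfswap : ∫⁻ z : 𝔼 × 𝔼, f z.swap = ∫⁻ z, f z := by
    rw [Measure.volume_eq_prod]
    exact lintegral_prod_swap f
  refine lt_of_le_of_lt (b := ∫⁻ z : 𝔼 × 𝔼, (f z + f z.swap)) ?_ ?_
  swap
  · rw [lintegral_add_left hfm, hfswap]
    exact ENNReal.add_lt_top.2 ⟨hffin, hffin⟩
  refine lintegral_mono fun z => ?_
  have hbound : |η z.1 - η z.2| ^ p / ‖z.1 - z.2‖ ^ ((N : ℝ) + s * p) ≤ A * k (z.1 - z.2) := by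
    rcases eq_or_ne z.1 z.2 with h | h
    · rw [h, sub_self, abs_zero, Real.zero_rpow hp.ne', zero_div]
      exact mul_nonneg hA0 (hk0 _)
    have hz : 0 < ‖z.1 - z.2‖ := norm_pos_iff.2 (sub_ne_zero.2 h)
    simp only [hk]
    split_ifs with h1
    · have hl : |η z.1 - η z.2| ≤ L * ‖z.1 - z.2‖ := by
        simpa [Real.dist_eq, dist_eq_norm] using hL.dist_le_mul z.1 z.2
      rw [Real.rpow_sub hz, ← mul_div_assoc]
      refine div_le_div_of_nonneg_right ?_ (by positivity)
      calc |η z.1 - η z.2| ^ p ≤ (L * ‖z.1 - z.2‖) ^ p :=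
            Real.rpow_le_rpow (abs_nonneg _) hl hp.le
        _ = (L : ℝ) ^ p * ‖z.1 - z.2‖ ^ p := Real.mul_rpow L.2 hz.le
        _ ≤ A * ‖z.1 - z.2‖ ^ p :=
            mul_le_mul_of_nonneg_right (le_add_of_nonneg_right (by positivity)) (by positivity)
    · rw [Real.rpow_neg hz.le, ← div_eq_mul_inv]
      refine div_le_div_of_nonneg_right ?_ (by positivity)
      have hl : |η z.1 - η z.2| ≤ 2 * M := by
        have h1 := hM z.1
        have h2 := hM z.2
        rw [Real.norm_eq_abs] at h1 h2
        linarith [abs_sub (η z.1) (η z.2)]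
      exact (Real.rpow_le_rpow (abs_nonneg _) hl hp.le).trans
        (le_add_of_nonneg_left (by positivity))
  by_cases h1 : z.1 ∈ K
  · refine le_add_right ?_
    simp only [hf, indicator_of_mem h1, one_mul]
    exact ENNReal.ofReal_le_ofReal hbound
  by_cases h2 : z.2 ∈ K
  · refine le_add_left ?_
    simp only [hf, Prod.fst_swap, Prod.snd_swap, indicator_of_mem h2, one_mul]
    rw [← neg_sub z.1 z.2, hksymm]
    exact ENNReal.ofReal_le_ofReal hbound
  · rw [image_eq_zero_of_notMem_tsupport h1, image_eq_zero_of_notMem_tsupport h2, sub_zero,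
      abs_zero, Real.zero_rpow hp.ne', zero_div, ENNReal.ofReal_zero]
    exact zero_le

/-! ### The Poincaré inequality -/

/-- The fractional Poincaré inequality on a bounded set. It compares the values of `u` with the
value `0` that `u` takes on a ball disjoint from `Ω`. -/
theorem exists_eLpNorm_le_mul_fracQuotient [NeZero N] {s p : ℝ} (hs0 : 0 < s) (hp : 0 < p)
    {Ω : Set 𝔼} (hΩ : Bornology.IsBounded Ω) :
    ∃ C : ℝ≥0∞, C ≠ ⊤ ∧ ∀ u : 𝔼 → ℝ, AEStronglyMeasurable u volume →
      (∀ᵐ x ∂volume, x ∉ Ω → u x = 0) →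
      eLpNorm u (ENNReal.ofReal p) volume ≤
        C * eLpNorm (fracQuotient s p u) (ENNReal.ofReal p) volume := by
  have : Nonempty (Fin N) := ⟨⟨0, Nat.pos_of_ne_zero (NeZero.ne N)⟩⟩
  obtain ⟨R, hR0, hR⟩ : ∃ R : ℝ, 0 < R ∧ Ω ⊆ Metric.closedBall 0 R := by
    obtain ⟨R, hR⟩ := hΩ.subset_closedBall 0
    exact ⟨max R 1, by positivity, hR.trans (Metric.closedBall_subset_closedBall (le_max_left _ _))⟩
  -- A centre at distance `R + 1` from the origin makes the unit ball `B` miss `Ω`. Points of `Ω`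
  -- and `B` are then at distance at most `R + (R + 2)`, whence `d`.
  obtain ⟨x₀, hx₀⟩ := exists_norm_eq 𝔼 (show 0 ≤ R + 1 by linarith)
  set B := Metric.ball x₀ 1 with hB
  have hBm : MeasurableSet B := measurableSet_ball
  have hB0 : volume B ≠ 0 := (Metric.measure_ball_pos volume x₀ one_pos).ne'
  have hBtop : volume B ≠ ⊤ := measure_ball_lt_top.ne
  have hBΩ : ∀ y ∈ B, y ∉ Ω := fun y hy hyΩ => by
    have h1 : ‖y‖ ≤ R := by simpa using hR hyΩ
    have h2 : ‖y - x₀‖ < 1 := mem_ball_iff_norm.1 hy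
    have h3 : ‖x₀‖ ≤ ‖y‖ + ‖y - x₀‖ := by
      calc ‖x₀‖ = ‖y - (y - x₀)‖ := by simp
        _ ≤ _ := norm_sub_le _ _
    linarith
  set q : ℝ := (N : ℝ) + s * p with hq
  have hq0 : 0 < q := by positivity
  set d : ℝ := (2 * R + 2) ^ q with hd
  have hd0 : 0 < d := by positivity
  refine ⟨(ENNReal.ofReal d / volume B) ^ (1 / p), ?_, fun u hu hu0 => ?_⟩
  · exact ENNReal.rpow_ne_top_of_nonneg (by positivity)
      (ENNReal.div_ne_top ENNReal.ofReal_ne_top hB0)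
  rw [eLpNorm_ofReal_eq hp, eLpNorm_ofReal_eq hp, ← ENNReal.mul_rpow_of_nonneg _ _ (by positivity)]
  refine ENNReal.rpow_le_rpow ?_ (by positivity)
  -- For `x ∈ Ω` and `y ∈ B` one has `u y = 0`, so `|u x|^p` is at most `d` times the Gagliardo
  -- integrand at `(x, y)`; this is integrated over the pairs.
  have hkey : (∫⁻ x, ‖u x‖ₑ ^ p) * volume B ≤
      ENNReal.ofReal d * ∫⁻ z, ‖fracQuotient s p u z‖ₑ ^ p := by
    have hum : AEMeasurable (fun x => ‖u x‖ₑ ^ p) volume := hu.aemeasurable.enorm.pow_const p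
    calc (∫⁻ x, ‖u x‖ₑ ^ p) * volume B
        = (∫⁻ x, ‖u x‖ₑ ^ p) * ∫⁻ y, B.indicator (fun _ => (1 : ℝ≥0∞)) y := by
          rw [lintegral_indicator hBm]; simp
      _ = ∫⁻ z : 𝔼 × 𝔼, ‖u z.1‖ₑ ^ p * B.indicator (fun _ => (1 : ℝ≥0∞)) z.2 := by
          rw [Measure.volume_eq_prod]
          exact (lintegral_prod_mul hum (measurable_const.indicator hBm).aemeasurable).symm
      _ ≤ ∫⁻ z, ENNReal.ofReal d * ‖fracQuotient s p u z‖ₑ ^ p := by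
          refine lintegral_mono_ae ?_
          filter_upwards [quasiMeasurePreserving_fst_volume.ae hu0,
            quasiMeasurePreserving_snd_volume.ae hu0] with z h1 h2
          by_cases hz2 : z.2 ∈ B
          swap
          · simp [hz2]
          by_cases hz1 : z.1 ∈ Ω
          swap
          · simp [h1 hz1, hp]
          rw [indicator_of_mem hz2, mul_one, enorm_fracQuotient_rpow hp, h2 (hBΩ _ hz2), sub_zero,
            Real.enorm_eq_ofReal_abs, ENNReal.ofReal_rpow_of_nonneg (abs_nonneg _) hp.le,
            ← ENNReal.ofReal_mul hd0.le]
          refine ENNReal.ofReal_le_ofReal ?_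
          have hne : z.1 ≠ z.2 := fun h => hBΩ _ hz2 (h ▸ hz1)
          have hpos : 0 < ‖z.1 - z.2‖ := norm_pos_iff.2 (sub_ne_zero.2 hne)
          have hle : ‖z.1 - z.2‖ ≤ 2 * R + 2 := by
            have h1 : ‖z.1‖ ≤ R := by simpa using hR hz1
            have h2 : ‖z.2 - x₀‖ < 1 := mem_ball_iff_norm.1 hz2
            have h3 : ‖z.2‖ ≤ ‖x₀‖ + ‖z.2 - x₀‖ := by
              calc ‖z.2‖ = ‖x₀ + (z.2 - x₀)‖ := by simp
                _ ≤ _ := norm_add_le _ _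
            linarith [norm_sub_le z.1 z.2]
          rw [← mul_div_assoc, le_div_iff₀ (by positivity), mul_comm d]
          exact mul_le_mul_of_nonneg_left (Real.rpow_le_rpow hpos.le hle hq0.le) (by positivity)
      _ = ENNReal.ofReal d * ∫⁻ z, ‖fracQuotient s p u z‖ₑ ^ p :=
          lintegral_const_mul' _ _ ENNReal.ofReal_ne_top
  rw [mul_comm, ← mul_div_assoc, mul_comm, ENNReal.le_div_iff_mul_le (Or.inl hB0) (Or.inl hBtop)]
  exact hkey

end Quotient

/-! ### The space `W_0^{s,p}(Ω)` -/

section Space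

variable {N : ℕ} {s p : ℝ} {Ω : Set (EuclideanSpace ℝ (Fin N))}
  {u v : EuclideanSpace ℝ (Fin N) → ℝ}

local notation "𝔼" => EuclideanSpace ℝ (Fin N)

theorem eLpNorm_fracQuotient_sub_comm (s p : ℝ) (u v : 𝔼 → ℝ) :
    eLpNorm (fracQuotient s p (fun x => u x - v x)) (ENNReal.ofReal p) volume =
      eLpNorm (fracQuotient s p (fun x => v x - u x)) (ENNReal.ofReal p) volume := by
  rw [fracQuotient_sub, fracQuotient_sub]
  exact eLpNorm_sub_comm (fracQuotient s p u) (fracQuotient s p v) _ _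

theorem eLpNorm_fracQuotient_sub_le (hp : 1 ≤ p) {u v w : 𝔼 → ℝ}
    (hu : AEStronglyMeasurable u volume) (hv : AEStronglyMeasurable v volume)
    (hw : AEStronglyMeasurable w volume) :
    eLpNorm (fracQuotient s p (fun x => u x - w x)) (ENNReal.ofReal p) volume ≤
      eLpNorm (fracQuotient s p (fun x => u x - v x)) (ENNReal.ofReal p) volume +
      eLpNorm (fracQuotient s p (fun x => v x - w x)) (ENNReal.ofReal p) volume := by
  have : (fun x => u x - w x) = fun x => (u x - v x) + (v x - w x) := by ext; ring
  rw [this, fracQuotient_add]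
  exact eLpNorm_add_le (aestronglyMeasurable_fracQuotient s p (hu.sub hv))
    (aestronglyMeasurable_fracQuotient s p (hv.sub hw)) (by simpa using hp)

theorem IsTestFunction.memLp_fracQuotient [NeZero N] (hs0 : 0 < s) (hs1 : s < 1) (hp : 0 < p)
    {η : 𝔼 → ℝ} (hη : IsTestFunction Ω η) :
    MemLp (fracQuotient s p η) (ENNReal.ofReal p) volume := by
  obtain ⟨L, hL⟩ := ContDiff.lipschitzWith_of_hasCompactSupport hη.2.1 hη.1 (by simp)
  refine ⟨aestronglyMeasurable_fracQuotient s p hη.1.continuous.aestronglyMeasurable, ?_⟩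
  rw [← gagliardoSeminorm_eq_eLpNorm hp]
  exact gagliardoSeminorm_lt_top_of_lipschitz hs0 hs1 hp hL hη.2.1

theorem IsTestFunction.eq_zero_of_notMem {η : 𝔼 → ℝ} (hη : IsTestFunction Ω η) {x : 𝔼}
    (hx : x ∉ Ω) : η x = 0 :=
  image_eq_zero_of_notMem_tsupport fun h => hx (hη.2.2 h)

theorem IsTestFunction.memW0 (hp : 0 < p) {η : 𝔼 → ℝ} (hη : IsTestFunction Ω η) :
    MemW0 s p Ω η where
  aestronglyMeasurable := hη.1.continuous.aestronglyMeasurable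
  ae_eq_zero := Filter.Eventually.of_forall fun _ hx => hη.eq_zero_of_notMem hx
  approx ε hε := by
    refine ⟨η, hη, ?_⟩
    simp only [sub_self]
    rw [gagliardoSeminorm_eq_eLpNorm hp]
    have : fracQuotient s p (fun _ : 𝔼 => (0 : ℝ)) = fun _ => 0 := by ext; simp [fracQuotient]
    rw [this, normL]
    simpa using hε

theorem MemW0.exists_testFunction (h : MemW0 s p Ω u) (hp : 0 < p) {ε : ℝ≥0∞} (hε : 0 < ε) :
    ∃ η : 𝔼 → ℝ, IsTestFunction Ω η ∧
      eLpNorm (fracQuotient s p (fun x => u x - η x)) (ENNReal.ofReal p) volume < ε := by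
  obtain ⟨η, hη, hlt⟩ := h.approx ε hε
  rw [gagliardoSeminorm_eq_eLpNorm hp] at hlt
  exact ⟨η, hη, le_self_add.trans_lt hlt⟩

theorem MemW0.memLp_fracQuotient [NeZero N] (h : MemW0 s p Ω u) (hs0 : 0 < s) (hs1 : s < 1)
    (hp : 0 < p) : MemLp (fracQuotient s p u) (ENNReal.ofReal p) volume := by
  obtain ⟨η, hη, hlt⟩ := h.exists_testFunction hp (ε := 1) one_pos
  have h1 : MemLp (fracQuotient s p (fun x => u x - η x)) (ENNReal.ofReal p) volume :=
    ⟨aestronglyMeasurable_fracQuotient s p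
      (h.aestronglyMeasurable.sub hη.1.continuous.aestronglyMeasurable),
      hlt.trans ENNReal.one_lt_top⟩
  have h2 := h1.add (hη.memLp_fracQuotient hs0 hs1 hp)
  convert h2 using 1
  ext z
  simp [fracQuotient_sub]

/-- By the Poincaré inequality, approximation in the Gagliardo seminorm suffices. -/
theorem memW0_of_exists_testFunction [NeZero N] (hs0 : 0 < s) (hp : 0 < p)
    (hΩ : Bornology.IsBounded Ω) (hu : AEStronglyMeasurable u volume)
    (hu0 : ∀ᵐ x ∂volume, x ∉ Ω → u x = 0)
    (h : ∀ ε : ℝ≥0∞, 0 < ε → ∃ η : 𝔼 → ℝ, IsTestFunction Ω η ∧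
      eLpNorm (fracQuotient s p (fun x => u x - η x)) (ENNReal.ofReal p) volume < ε) :
    MemW0 s p Ω u := by
  refine ⟨hu, hu0, fun ε hε => ?_⟩
  obtain ⟨C, hC, hP⟩ := exists_eLpNorm_le_mul_fracQuotient (s := s) hs0 hp hΩ
  have hC1 : 1 + C ≠ ⊤ := ENNReal.add_ne_top.2 ⟨ENNReal.one_ne_top, hC⟩
  obtain ⟨η, hη, hlt⟩ := h (ε / (1 + C)) (ENNReal.div_pos hε.ne' hC1)
  refine ⟨η, hη, ?_⟩
  rw [gagliardoSeminorm_eq_eLpNorm hp, normL]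
  have h1 : eLpNorm (fun x => u x - η x) (ENNReal.ofReal p) (volume.restrict Ω) ≤
      C * eLpNorm (fracQuotient s p (fun x => u x - η x)) (ENNReal.ofReal p) volume := by
    refine (eLpNorm_mono_measure _ Measure.restrict_le_self).trans
      (hP _ (hu.sub hη.1.continuous.aestronglyMeasurable) ?_)
    filter_upwards [hu0] with x hx hxΩ
    simp [hx hxΩ, hη.eq_zero_of_notMem hxΩ]
  calc _ ≤ (1 + C) * eLpNorm (fracQuotient s p (fun x => u x - η x)) (ENNReal.ofReal p) volume := by
        rw [add_mul, one_mul]; gcongr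
    _ < ε := ENNReal.mul_lt_of_lt_div' hlt

theorem memW0_of_exists_memW0 [NeZero N] (hs0 : 0 < s) (hp : 1 ≤ p)
    (hΩ : Bornology.IsBounded Ω) (hu : AEStronglyMeasurable u volume)
    (hu0 : ∀ᵐ x ∂volume, x ∉ Ω → u x = 0)
    (h : ∀ ε : ℝ≥0∞, 0 < ε → ∃ w : 𝔼 → ℝ, MemW0 s p Ω w ∧
      eLpNorm (fracQuotient s p (fun x => u x - w x)) (ENNReal.ofReal p) volume < ε) :
    MemW0 s p Ω u := by
  refine memW0_of_exists_testFunction hs0 (by linarith) hΩ hu hu0 fun ε hε => ?_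
  obtain ⟨w, hw, h1⟩ := h (ε / 2) (ENNReal.half_pos hε.ne')
  obtain ⟨η, hη, h2⟩ := hw.exists_testFunction (by linarith) (ENNReal.half_pos hε.ne')
  refine ⟨η, hη, (eLpNorm_fracQuotient_sub_le hp hu hw.aestronglyMeasurable
    hη.1.continuous.aestronglyMeasurable).trans_lt ?_⟩
  calc _ < ε / 2 + ε / 2 := ENNReal.add_lt_add h1 h2
    _ = ε := ENNReal.add_halves ε

theorem IsTestFunction.add {η ζ : 𝔼 → ℝ} (hη : IsTestFunction Ω η) (hζ : IsTestFunction Ω ζ) :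
    IsTestFunction Ω (fun x => η x + ζ x) :=
  ⟨hη.1.add hζ.1, hη.2.1.add hζ.2.1,
    (tsupport_add η ζ).trans (union_subset hη.2.2 hζ.2.2)⟩

theorem IsTestFunction.const_mul (c : ℝ) {η : 𝔼 → ℝ} (hη : IsTestFunction Ω η) :
    IsTestFunction Ω (fun x => c * η x) :=
  ⟨contDiff_const.mul hη.1, hη.2.1.mul_left,
    (tsupport_mul_subset_right (f := fun _ => c)).trans hη.2.2⟩

theorem MemW0.add [NeZero N] (hs0 : 0 < s) (hp : 1 ≤ p) (hΩ : Bornology.IsBounded Ω)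
    (hu : MemW0 s p Ω u) (hv : MemW0 s p Ω v) : MemW0 s p Ω (fun x => u x + v x) := by
  have hp0 : 0 < p := by linarith
  refine memW0_of_exists_testFunction hs0 hp0 hΩ
    (hu.aestronglyMeasurable.add hv.aestronglyMeasurable) ?_ fun ε hε => ?_
  · filter_upwards [hu.ae_eq_zero, hv.ae_eq_zero] with x h1 h2 hx
    simp [h1 hx, h2 hx]
  obtain ⟨η, hη, h1⟩ := hu.exists_testFunction hp0 (ENNReal.half_pos hε.ne')
  obtain ⟨ζ, hζ, h2⟩ := hv.exists_testFunction hp0 (ENNReal.half_pos hε.ne')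
  refine ⟨_, hη.add hζ, ?_⟩
  have : (fun x => u x + v x - (η x + ζ x)) = fun x => (u x - η x) + (v x - ζ x) := by ext; ring
  rw [this, fracQuotient_add]
  refine (eLpNorm_add_le (aestronglyMeasurable_fracQuotient s p (hu.aestronglyMeasurable.sub
      hη.1.continuous.aestronglyMeasurable)) (aestronglyMeasurable_fracQuotient s p
      (hv.aestronglyMeasurable.sub hζ.1.continuous.aestronglyMeasurable))
      (by simpa using hp)).trans_lt ?_
  calc _ < ε / 2 + ε / 2 := ENNReal.add_lt_add h1 h2
    _ = ε := ENNReal.add_halves ε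

theorem eLpNorm_fracQuotient_const_mul (s p c : ℝ) (u : 𝔼 → ℝ) :
    eLpNorm (fracQuotient s p (fun x => c * u x)) (ENNReal.ofReal p) volume =
      ‖c‖ₑ * eLpNorm (fracQuotient s p u) (ENNReal.ofReal p) volume := by
  rw [fracQuotient_const_mul]
  exact eLpNorm_const_smul c (fracQuotient s p u) _ _

theorem MemW0.const_mul [NeZero N] (hs0 : 0 < s) (hp : 1 ≤ p) (hΩ : Bornology.IsBounded Ω)
    (hu : MemW0 s p Ω u) (c : ℝ) : MemW0 s p Ω (fun x => c * u x) := by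
  have hp0 : 0 < p := by linarith
  refine memW0_of_exists_testFunction hs0 hp0 hΩ
    (hu.aestronglyMeasurable.const_mul c) ?_ fun ε hε => ?_
  · filter_upwards [hu.ae_eq_zero] with x h1 hx
    simp [h1 hx]
  obtain ⟨η, hη, h1⟩ := hu.exists_testFunction hp0 (ENNReal.div_pos hε.ne' (enorm_ne_top (x := c)))
  refine ⟨_, hη.const_mul c, ?_⟩
  have : (fun x => c * u x - c * η x) = fun x => c * (u x - η x) := by ext; ring
  rw [this, eLpNorm_fracQuotient_const_mul]
  exact ENNReal.mul_lt_of_lt_div' h1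

theorem MemW0.sub [NeZero N] (hs0 : 0 < s) (hp : 1 ≤ p) (hΩ : Bornology.IsBounded Ω)
    (hu : MemW0 s p Ω u) (hv : MemW0 s p Ω v) : MemW0 s p Ω (fun x => u x - v x) := by
  have := hu.add hs0 hp hΩ (hv.const_mul hs0 hp hΩ (-1))
  simpa [sub_eq_add_neg] using this

/-- An element of `W_0^{s,p}(Ω)` with vanishing seminorm is zero almost everywhere. -/
theorem MemW0.ae_eq_zero_of_fracQuotient [NeZero N] (hs0 : 0 < s) (hp : 0 < p)
    (hΩ : Bornology.IsBounded Ω) (hu : MemW0 s p Ω u)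
    (h : fracQuotient s p u =ᵐ[volume] 0) : u =ᵐ[volume] 0 := by
  obtain ⟨C, -, hP⟩ := exists_eLpNorm_le_mul_fracQuotient (s := s) hs0 hp hΩ
  have h1 := hP u hu.aestronglyMeasurable hu.ae_eq_zero
  have hp' : ENNReal.ofReal p ≠ 0 := by simpa using hp
  rw [eLpNorm_congr_ae h, eLpNorm_zero, mul_zero, nonpos_iff_eq_zero,
    eLpNorm_eq_zero_iff hu.aestronglyMeasurable hp'] at h1
  exact h1

/-- `W_0^{s,p}(Ω)` is complete for the Gagliardo seminorm. -/
theorem exists_memW0_tendsto_of_cauchy [NeZero N] (hs0 : 0 < s) (hp : 1 ≤ p)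
    (hΩ : Bornology.IsBounded Ω) {f : ℕ → 𝔼 → ℝ} (hf : ∀ n, MemW0 s p Ω (f n))
    (hc : ∀ ε : ℝ≥0∞, 0 < ε → ∃ M, ∀ m n, M ≤ m → M ≤ n →
      eLpNorm (fracQuotient s p (fun x => f m x - f n x)) (ENNReal.ofReal p) volume < ε) :
    ∃ u, MemW0 s p Ω u ∧ Filter.Tendsto
      (fun n => eLpNorm (fracQuotient s p (fun x => f n x - u x)) (ENNReal.ofReal p) volume)
      Filter.atTop (nhds 0) := by
  have hp0 : 0 < p := by linarith
  obtain ⟨C, hC, hP⟩ := exists_eLpNorm_le_mul_fracQuotient (s := s) hs0 hp0 hΩ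
  -- By Poincaré the sequence is Cauchy in `L^p`; a subsequence with gaps below the summable
  -- `2^(-k)` converges almost everywhere.
  have hev : ∀ k : ℕ, ∀ᶠ M in Filter.atTop, ∀ m n, M ≤ m → M ≤ n →
      eLpNorm (f m - f n) (ENNReal.ofReal p) volume < (2⁻¹ : ℝ≥0∞) ^ k := fun k => by
    have hk : 0 < (2⁻¹ : ℝ≥0∞) ^ k := ENNReal.pow_pos (by simp) k
    obtain ⟨M, hM⟩ := hc ((2⁻¹ : ℝ≥0∞) ^ k / C) (ENNReal.div_pos hk.ne' hC)
    filter_upwards [Filter.eventually_ge_atTop M] with M' hM' m n hm hn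
    refine (hP _ ((hf m).aestronglyMeasurable.sub (hf n).aestronglyMeasurable) ?_).trans_lt
      (ENNReal.mul_lt_of_lt_div' (hM m n (hM'.trans hm) (hM'.trans hn)))
    filter_upwards [(hf m).ae_eq_zero, (hf n).ae_eq_zero] with x h1 h2 hx
    simp [h1 hx, h2 hx]
  obtain ⟨φ, hφ, hφB⟩ := Filter.extraction_forall_of_eventually hev
  have hlim : ∀ᵐ x ∂(volume : Measure 𝔼),
      ∃ l, Filter.Tendsto (fun k => f (φ k) x) Filter.atTop (nhds l) := by
    refine Lp.ae_tendsto_of_cauchy_eLpNorm (p := ENNReal.ofReal p) (B := fun k => 2⁻¹ ^ k)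
      (fun k => (hf (φ k)).aestronglyMeasurable) (by simpa using hp) ?_ fun k m n hm hn =>
      hφB k _ _ (hφ.monotone hm) (hφ.monotone hn)
    rw [ENNReal.tsum_geometric]
    simp
  obtain ⟨u, hum, hu⟩ := exists_stronglyMeasurable_limit_of_tendsto_ae
    (fun k => (hf (φ k)).aestronglyMeasurable) hlim
  have huae : AEStronglyMeasurable u volume := hum.aestronglyMeasurable
  have hu0 : ∀ᵐ x ∂(volume : Measure 𝔼), x ∉ Ω → u x = 0 := by
    filter_upwards [hu, ae_all_iff.2 fun k => (hf (φ k)).ae_eq_zero] with x h1 h2 hx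
    refine tendsto_nhds_unique h1 ?_
    simp [h2 _ hx]
  -- Fatou along the subsequence: the difference quotients of `f n - f (φ k)` converge almost
  -- everywhere to those of `f n - u`, so the Cauchy bound passes to the limit in the second index.
  have hfatou : ∀ ε : ℝ≥0∞, 0 < ε → ∃ M, ∀ n, M ≤ n →
      eLpNorm (fracQuotient s p (fun x => f n x - u x)) (ENNReal.ofReal p) volume ≤ ε := by
    intro ε hε
    obtain ⟨M, hM⟩ := hc ε hε
    refine ⟨M, fun n hn => ?_⟩
    have h1 : ∀ᵐ z ∂(volume : Measure (𝔼 × 𝔼)), Filter.Tendsto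
        (fun k => fracQuotient s p (fun x => f n x - f (φ k) x) z) Filter.atTop
        (nhds (fracQuotient s p (fun x => f n x - u x) z)) := by
      filter_upwards [quasiMeasurePreserving_fst_volume.ae hu,
        quasiMeasurePreserving_snd_volume.ae hu] with z h1 h2
      exact ((tendsto_const_nhds.sub h1).sub (tendsto_const_nhds.sub h2)).div_const _
    refine (Lp.eLpNorm_lim_le_liminf_eLpNorm (fun k => aestronglyMeasurable_fracQuotient s p
      ((hf n).aestronglyMeasurable.sub (hf (φ k)).aestronglyMeasurable)) _ h1).trans ?_
    refine Filter.liminf_le_of_frequently_le' (Filter.Eventually.frequently ?_)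
    filter_upwards [hφ.tendsto_atTop.eventually_ge_atTop M] with k hk
    exact (hM n (φ k) hn hk).le
  refine ⟨u, memW0_of_exists_memW0 hs0 hp hΩ huae hu0 fun ε hε => ?_, ?_⟩
  · obtain ⟨δ, hδ, hδε⟩ := exists_between hε
    obtain ⟨M, hM⟩ := hfatou δ hδ
    refine ⟨f M, hf M, ?_⟩
    rw [eLpNorm_fracQuotient_sub_comm]
    exact (hM M le_rfl).trans_lt hδε
  · rw [ENNReal.tendsto_nhds_zero]
    intro ε hε
    obtain ⟨M, hM⟩ := hfatou ε hε
    filter_upwards [Filter.eventually_ge_atTop M] with n hn using hM n hn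

end Space

/-! ### The energy functional -/

section Energy

variable {N : ℕ} {s p : ℝ} {Ω : Set (EuclideanSpace ℝ (Fin N))}
  {u v : EuclideanSpace ℝ (Fin N) → ℝ}

local notation "𝔼" => EuclideanSpace ℝ (Fin N)

/-- The real number `[u]_{s,p} ^ p`, as a Bochner integral. -/
noncomputable def gagliardoEnergy (s p : ℝ) (u : EuclideanSpace ℝ (Fin N) → ℝ) : ℝ :=
  ∫ z, |fracQuotient s p u z| ^ p

/-- The functional `[u]_{s,p} ^ p / p - ∫_Ω u`, whose minimizer is the torsion function. -/
noncomputable def torsionEnergy (s p : ℝ) (Ω : Set (EuclideanSpace ℝ (Fin N)))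
    (u : EuclideanSpace ℝ (Fin N) → ℝ) : ℝ :=
  gagliardoEnergy s p u / p - ∫ x in Ω, u x

theorem gagliardoEnergy_nonneg (s p : ℝ) (u : 𝔼 → ℝ) : 0 ≤ gagliardoEnergy s p u :=
  integral_nonneg fun _ => by positivity

theorem gagliardoEnergy_const_mul (s p c : ℝ) (u : 𝔼 → ℝ) :
    gagliardoEnergy s p (fun x => c * u x) = |c| ^ p * gagliardoEnergy s p u := by
  simp only [gagliardoEnergy, fracQuotient_const_mul, abs_mul,
    Real.mul_rpow (abs_nonneg _) (abs_nonneg _)]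
  exact integral_const_mul _ _

theorem MeasureTheory.MemLp.integrable_abs_rpow {α : Type*} [MeasurableSpace α] {μ : Measure α}
    (hp : 0 < p) {f : α → ℝ} (hf : MemLp f (ENNReal.ofReal p) μ) :
    Integrable (fun x => |f x| ^ p) μ := by
  have := hf.integrable_norm_rpow (by simpa using hp) ENNReal.ofReal_ne_top
  simpa [ENNReal.toReal_ofReal hp.le] using this

variable [NeZero N]

theorem MemW0.integrable_abs_fracQuotient_rpow (hs0 : 0 < s) (hs1 : s < 1) (hp : 0 < p)
    (hu : MemW0 s p Ω u) : Integrable (fun z => |fracQuotient s p u z| ^ p) volume :=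
  (hu.memLp_fracQuotient hs0 hs1 hp).integrable_abs_rpow hp

theorem MemW0.gagliardoSeminorm_rpow (hs0 : 0 < s) (hs1 : s < 1) (hp : 0 < p)
    (hu : MemW0 s p Ω u) : gagliardoSeminorm s p u ^ p = ENNReal.ofReal (gagliardoEnergy s p u) := by
  rw [gagliardoSeminorm, ← ENNReal.rpow_mul, one_div, inv_mul_cancel₀ hp.ne', ENNReal.rpow_one,
    gagliardoEnergy, ofReal_integral_eq_lintegral_ofReal
      (hu.integrable_abs_fracQuotient_rpow hs0 hs1 hp)
      (Filter.Eventually.of_forall fun _ => by positivity)]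
  simp only [abs_fracQuotient_rpow hp]

theorem MemW0.gagliardoEnergy_eq (hs0 : 0 < s) (hs1 : s < 1) (hp : 0 < p) (hu : MemW0 s p Ω u) :
    gagliardoEnergy s p u =
      (eLpNorm (fracQuotient s p u) (ENNReal.ofReal p) volume).toReal ^ p := by
  rw [← gagliardoSeminorm_eq_eLpNorm hp, ENNReal.toReal_rpow, hu.gagliardoSeminorm_rpow hs0 hs1 hp,
    ENNReal.toReal_ofReal (gagliardoEnergy_nonneg _ _ _)]

/-- Elements of `W_0^{s,p}(Ω)` are integrable over `Ω`, with an `L^1` bound by the seminorm. -/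
theorem exists_integral_abs_le (hs0 : 0 < s) (hs1 : s < 1) (hp : 1 ≤ p)
    (hΩ : Bornology.IsBounded Ω) :
    ∃ C : ℝ, ∀ u : 𝔼 → ℝ, MemW0 s p Ω u → IntegrableOn u Ω ∧ ∫ x in Ω, |u x| ≤
      C * (eLpNorm (fracQuotient s p u) (ENNReal.ofReal p) volume).toReal := by
  have hp0 : 0 < p := by linarith
  have hp1 : 1 ≤ ENNReal.ofReal p := by simpa using hp
  obtain ⟨C, hC, hP⟩ := exists_eLpNorm_le_mul_fracQuotient (s := s) hs0 hp0 hΩ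
  have hvol : volume Ω ≠ ⊤ := hΩ.measure_lt_top.ne
  have : IsFiniteMeasure (volume.restrict Ω) := ⟨by simpa using hvol.lt_top⟩
  -- The Hölder factor `|Ω|^(1 - 1/p)`.
  set b : ℝ≥0∞ := (volume.restrict Ω) univ ^
    (1 / (1 : ℝ≥0∞).toReal - 1 / (ENNReal.ofReal p).toReal) with hb
  have hbtop : b ≠ ⊤ := by
    refine ENNReal.rpow_ne_top_of_nonneg ?_ (by simpa using hvol)
    rw [ENNReal.toReal_ofReal hp0.le, ENNReal.toReal_one, sub_nonneg]
    exact one_div_le_one_div_of_le one_pos hp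
  refine ⟨(C * b).toReal, fun u hu => ?_⟩
  have hfin := (hu.memLp_fracQuotient hs0 hs1 hp0).eLpNorm_lt_top
  have hm : AEStronglyMeasurable u (volume.restrict Ω) := hu.aestronglyMeasurable.restrict
  have hle : eLpNorm u 1 (volume.restrict Ω) ≤
      C * b * eLpNorm (fracQuotient s p u) (ENNReal.ofReal p) volume := by
    refine (eLpNorm_le_eLpNorm_mul_rpow_measure_univ hp1 hm).trans ?_
    calc _ ≤ (C * eLpNorm (fracQuotient s p u) (ENNReal.ofReal p) volume) * b := by
          gcongr
          exact (eLpNorm_mono_measure _ Measure.restrict_le_self).trans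
            (hP u hu.aestronglyMeasurable hu.ae_eq_zero)
      _ = _ := by ring
  have hrtop : C * b * eLpNorm (fracQuotient s p u) (ENNReal.ofReal p) volume ≠ ⊤ :=
    ENNReal.mul_ne_top (ENNReal.mul_ne_top hC hbtop) hfin.ne
  have hint : IntegrableOn u Ω := memLp_one_iff_integrable.1 ⟨hm, hle.trans_lt hrtop.lt_top⟩
  refine ⟨hint, ?_⟩
  have h1 := ENNReal.toReal_mono hrtop hle
  rw [ENNReal.toReal_mul, eLpNorm_one_eq_lintegral_enorm, ← integral_norm_eq_lintegral_enorm hm]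
    at h1
  simpa using h1

theorem MemW0.integrableOn (hs0 : 0 < s) (hs1 : s < 1) (hp : 1 ≤ p)
    (hΩ : Bornology.IsBounded Ω) (hu : MemW0 s p Ω u) : IntegrableOn u Ω :=
  ((exists_integral_abs_le hs0 hs1 hp hΩ).choose_spec u hu).1

/-- The energy is continuous along sequences converging in the Gagliardo seminorm. -/
theorem tendsto_gagliardoEnergy (hs0 : 0 < s) (hs1 : s < 1) (hp : 1 ≤ p)
    {f : ℕ → 𝔼 → ℝ} (hf : ∀ n, MemW0 s p Ω (f n)) (hu : MemW0 s p Ω u)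
    (h : Filter.Tendsto
      (fun n => eLpNorm (fracQuotient s p (fun x => f n x - u x)) (ENNReal.ofReal p) volume)
      Filter.atTop (nhds 0)) :
    Filter.Tendsto (fun n => gagliardoEnergy s p (f n)) Filter.atTop
      (nhds (gagliardoEnergy s p u)) := by
  have hp0 : 0 < p := by linarith
  have hp1 : 1 ≤ ENNReal.ofReal p := by simpa using hp
  simp only [fun n => (hf n).gagliardoEnergy_eq hs0 hs1 hp0, hu.gagliardoEnergy_eq hs0 hs1 hp0]
  refine Filter.Tendsto.rpow_const ?_ (Or.inr hp0.le)
  have : Fact (1 ≤ ENNReal.ofReal p) := ⟨hp1⟩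
  have hLp : Filter.Tendsto (fun n => ((hf n).memLp_fracQuotient hs0 hs1 hp0).toLp)
      Filter.atTop (nhds (hu.memLp_fracQuotient hs0 hs1 hp0).toLp) := by
    rw [Lp.tendsto_Lp_iff_tendsto_eLpNorm'']
    simpa only [fracQuotient_sub, Pi.sub_def] using h
  have h2 := hLp.norm
  simpa only [Lp.norm_toLp] using h2

theorem tendsto_integral_of_fracQuotient (hs0 : 0 < s) (hs1 : s < 1) (hp : 1 ≤ p)
    (hΩ : Bornology.IsBounded Ω)
    {f : ℕ → 𝔼 → ℝ} (hf : ∀ n, MemW0 s p Ω (f n)) (hu : MemW0 s p Ω u)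
    (h : Filter.Tendsto
      (fun n => eLpNorm (fracQuotient s p (fun x => f n x - u x)) (ENNReal.ofReal p) volume)
      Filter.atTop (nhds 0)) :
    Filter.Tendsto (fun n => ∫ x in Ω, f n x) Filter.atTop (nhds (∫ x in Ω, u x)) ∧
    Filter.Tendsto (fun n => ∫ x in Ω, |f n x|) Filter.atTop (nhds (∫ x in Ω, |u x|)) := by
  obtain ⟨C, hC⟩ := exists_integral_abs_le hs0 hs1 hp hΩ
  have hz : Filter.Tendsto (fun n => C *
      (eLpNorm (fracQuotient s p (fun x => f n x - u x)) (ENNReal.ofReal p) volume).toReal)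
      Filter.atTop (nhds 0) := by
    have := ((ENNReal.tendsto_toReal ENNReal.zero_ne_top).comp h).const_mul C
    simpa using this
  have hL1 : Filter.Tendsto (fun n => ∫ x in Ω, |f n x - u x|) Filter.atTop (nhds 0) :=
    squeeze_zero (fun n => integral_nonneg fun _ => abs_nonneg _)
      (fun n => (hC _ ((hf n).sub hs0 hp hΩ hu)).2) hz
  have hui := (hC u hu).1
  have hfi := fun n => (hC _ (hf n)).1
  constructor
  · rw [tendsto_iff_dist_tendsto_zero]
    refine squeeze_zero (fun _ => dist_nonneg) (fun n => ?_) hL1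
    rw [Real.dist_eq, ← integral_sub (hfi n) hui]
    exact abs_integral_le_integral_abs
  · rw [tendsto_iff_dist_tendsto_zero]
    refine squeeze_zero (fun _ => dist_nonneg) (fun n => ?_) hL1
    rw [Real.dist_eq, ← integral_sub (hfi n).abs hui.abs]
    refine abs_integral_le_integral_abs.trans (integral_mono ((hfi n).abs.sub hui.abs).abs
      ((hfi n).sub hui).abs fun x => ?_)
    exact abs_abs_sub_abs_le_abs_sub _ _

/-- The linear term is at most `C [u]`, which half of `[u]^p / p` absorbs up to a constant. -/
theorem exists_coercive (hs0 : 0 < s) (hs1 : s < 1) (hp : 1 < p) (hΩ : Bornology.IsBounded Ω) :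
    ∃ B : ℝ, ∀ u : 𝔼 → ℝ, MemW0 s p Ω u →
      gagliardoEnergy s p u / (2 * p) - B ≤ torsionEnergy s p Ω u := by
  have hp0 : 0 < p := by linarith
  obtain ⟨C, hC⟩ := exists_integral_abs_le hs0 hs1 hp.le hΩ
  obtain ⟨B, hB⟩ := exists_mul_le_mul_rpow_add hp C (show 0 < 1 / (2 * p) by positivity)
  refine ⟨B, fun u hu => ?_⟩
  have h1 := hB _ (ENNReal.toReal_nonneg
    (a := eLpNorm (fracQuotient s p u) (ENNReal.ofReal p) volume))
  rw [← hu.gagliardoEnergy_eq hs0 hs1 hp0] at h1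
  have h2 := (hC u hu).2
  have h3 : ∫ x in Ω, u x ≤ ∫ x in Ω, |u x| :=
    (le_abs_self _).trans abs_integral_le_integral_abs
  have h4 : gagliardoEnergy s p u / p = gagliardoEnergy s p u / (2 * p) +
      1 / (2 * p) * gagliardoEnergy s p u := by field_simp; ring
  rw [torsionEnergy, h4]
  linarith

/-- Almost minimizers of the torsion energy are close to each other. -/
theorem exists_gagliardoEnergy_sub_le (hs0 : 0 < s) (hs1 : s < 1) (hp : 1 < p)
    (hΩ : Bornology.IsBounded Ω) {m : ℝ}
    (hm : ∀ u : 𝔼 → ℝ, MemW0 s p Ω u → m ≤ torsionEnergy s p Ω u) {ε : ℝ} (hε : 0 < ε) :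
    ∃ δ : ℝ, 0 < δ ∧ ∀ u v : 𝔼 → ℝ, MemW0 s p Ω u → MemW0 s p Ω v →
      torsionEnergy s p Ω u ≤ m + δ → torsionEnergy s p Ω v ≤ m + δ →
      gagliardoEnergy s p (fun x => u x - v x) ≤ ε := by
  have hp0 : 0 < p := by linarith
  obtain ⟨B, hB⟩ := exists_coercive (Ω := Ω) hs0 hs1 hp hΩ
  -- Coercivity bounds the energy of any almost minimizer by `Q`. Then `ε'` and `δ` are chosen so
  -- that the `ε'` term and the defect term each contribute at most `ε / 2`.
  set Q : ℝ := max (2 * p * (m + 1 + B)) 0 with hQ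
  have hQ0 : 0 ≤ Q := le_max_right _ _
  set ε' : ℝ := ε / (2 * (2 * Q + 1)) with hε'
  obtain ⟨C, hC0, hC⟩ := exists_abs_sub_rpow_le_midpoint hp (show 0 < ε' by positivity)
  refine ⟨min 1 (ε / (2 * (C * p + 1))), by positivity, fun u v hu hv hJu hJv => ?_⟩
  set δ : ℝ := min 1 (ε / (2 * (C * p + 1))) with hδ
  have hδ1 : δ ≤ 1 := min_le_left _ _
  have hGQ : ∀ w : 𝔼 → ℝ, MemW0 s p Ω w → torsionEnergy s p Ω w ≤ m + δ →
      gagliardoEnergy s p w ≤ Q := fun w hw hJ => by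
    have h1 := hB w hw
    have h2 : gagliardoEnergy s p w / (2 * p) ≤ m + 1 + B := by linarith
    rw [div_le_iff₀ (by positivity)] at h2
    exact (by linarith : gagliardoEnergy s p w ≤ 2 * p * (m + 1 + B)).trans (le_max_left _ _)
  have hmid : MemW0 s p Ω (fun x => (1 / 2) * (u x + v x)) :=
    (hu.add hs0 hp.le hΩ hv).const_mul hs0 hp.le hΩ _
  have hui := hu.integrable_abs_fracQuotient_rpow hs0 hs1 hp0
  have hvi := hv.integrable_abs_fracQuotient_rpow hs0 hs1 hp0
  have hmi := hmid.integrable_abs_fracQuotient_rpow hs0 hs1 hp0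
  have hdi := (hu.sub hs0 hp.le hΩ hv).integrable_abs_fracQuotient_rpow hs0 hs1 hp0
  have hint : gagliardoEnergy s p (fun x => u x - v x) ≤
      ε' * (gagliardoEnergy s p u + gagliardoEnergy s p v) +
      C * ((gagliardoEnergy s p u + gagliardoEnergy s p v) / 2 -
        gagliardoEnergy s p (fun x => (1 / 2) * (u x + v x))) := by
    simp only [gagliardoEnergy]
    have hsum : Integrable (fun z => |fracQuotient s p u z| ^ p + |fracQuotient s p v z| ^ p)
        volume := hui.add hvi
    have hhalf := hsum.div_const 2
    have hdefi : Integrable (fun z => (|fracQuotient s p u z| ^ p + |fracQuotient s p v z| ^ p) / 2 -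
        |fracQuotient s p (fun x => 1 / 2 * (u x + v x)) z| ^ p) volume := hhalf.sub hmi
    rw [← integral_add hui hvi, ← integral_div, ← integral_sub hhalf hmi,
      ← integral_const_mul, ← integral_const_mul,
      ← integral_add (hsum.const_mul ε') (hdefi.const_mul C)]
    refine integral_mono hdi ((hsum.const_mul ε').add (hdefi.const_mul C)) fun z => ?_
    have := hC (fracQuotient s p u z) (fracQuotient s p v z)
    simp only [fracQuotient_sub, fracQuotient_const_mul, fracQuotient_add]
    rwa [one_div_mul_eq_div]
  -- The midpoint also has energy at least `m`. As the linear term is exactly averaged at the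
  -- midpoint, the whole convexity defect of the seminorm part is at most `p δ`.
  have hJmid := hm _ hmid
  have hlin : ∫ x in Ω, (1 / 2) * (u x + v x) = ((∫ x in Ω, u x) + ∫ x in Ω, v x) / 2 := by
    rw [integral_const_mul, integral_add (hu.integrableOn hs0 hs1 hp.le hΩ)
      (hv.integrableOn hs0 hs1 hp.le hΩ)]
    ring
  rw [torsionEnergy, hlin] at hJmid
  simp only [torsionEnergy] at hJu hJv
  have hdefect : (gagliardoEnergy s p u + gagliardoEnergy s p v) / 2 -
      gagliardoEnergy s p (fun x => (1 / 2) * (u x + v x)) ≤ p * δ := by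
    have h1 : ((gagliardoEnergy s p u + gagliardoEnergy s p v) / 2 -
      gagliardoEnergy s p (fun x => (1 / 2) * (u x + v x))) / p ≤ δ := by
      have : ((gagliardoEnergy s p u + gagliardoEnergy s p v) / 2 -
        gagliardoEnergy s p (fun x => (1 / 2) * (u x + v x))) / p =
        (gagliardoEnergy s p u / p + gagliardoEnergy s p v / p) / 2 -
        gagliardoEnergy s p (fun x => (1 / 2) * (u x + v x)) / p := by ring
      linarith
    rw [div_le_iff₀ hp0] at h1
    linarith
  have hGu := hGQ u hu hJu
  have hGv := hGQ v hv hJv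
  have e1 : ε' * (gagliardoEnergy s p u + gagliardoEnergy s p v) ≤ ε / 2 := by
    calc _ ≤ ε' * (2 * Q + 1) := mul_le_mul_of_nonneg_left (by linarith) (by positivity)
      _ = ε / 2 := by rw [hε']; field_simp
  have e2 : C * (p * δ) ≤ ε / 2 := by
    calc C * (p * δ) = C * p * δ := by ring
      _ ≤ (C * p + 1) * (ε / (2 * (C * p + 1))) :=
          mul_le_mul (by linarith) (min_le_right _ _) (by positivity) (by positivity)
      _ = ε / 2 := by field_simp
  have e3 := mul_le_mul_of_nonneg_left hdefect hC0
  linarith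

/-- The torsion energy attains its minimum on `W_0^{s,p}(Ω)`. -/
theorem exists_minimizer (hs0 : 0 < s) (hs1 : s < 1) (hp : 1 < p) (hΩ : Bornology.IsBounded Ω) :
    ∃ φ : 𝔼 → ℝ, MemW0 s p Ω φ ∧
      ∀ u : 𝔼 → ℝ, MemW0 s p Ω u → torsionEnergy s p Ω φ ≤ torsionEnergy s p Ω u := by
  have hp0 : 0 < p := by linarith
  obtain ⟨B, hB⟩ := exists_coercive (Ω := Ω) hs0 hs1 hp hΩ
  set S : Set ℝ := torsionEnergy s p Ω '' {u | MemW0 s p Ω u} with hS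
  have hbdd : BddBelow S := by
    refine ⟨-B, ?_⟩
    rintro _ ⟨u, hu, rfl⟩
    have h1 := hB u hu
    have h2 : 0 ≤ gagliardoEnergy s p u / (2 * p) :=
      div_nonneg (gagliardoEnergy_nonneg _ _ _) (by positivity)
    linarith
  have hzero : IsTestFunction Ω (fun _ : 𝔼 => (0 : ℝ)) :=
    ⟨contDiff_const, HasCompactSupport.zero, by simp [tsupport]⟩
  have hne : S.Nonempty := ⟨_, _, hzero.memW0 hp0, rfl⟩
  set m := sInf S with hm
  have hmle : ∀ u : 𝔼 → ℝ, MemW0 s p Ω u → m ≤ torsionEnergy s p Ω u := fun u hu =>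
    csInf_le hbdd ⟨u, hu, rfl⟩
  have hseq : ∀ n : ℕ, ∃ u : 𝔼 → ℝ, MemW0 s p Ω u ∧
      torsionEnergy s p Ω u < m + 1 / ((n : ℝ) + 1) := fun n => by
    obtain ⟨_, ⟨u, hu, rfl⟩, hlt⟩ := exists_lt_of_csInf_lt hne
      (show sInf S < m + 1 / ((n : ℝ) + 1) from lt_add_of_pos_right _ (by positivity))
    exact ⟨u, hu, hlt⟩
  choose f hf hfJ using hseq
  have hcauchy : ∀ ε : ℝ≥0∞, 0 < ε → ∃ M, ∀ i j, M ≤ i → M ≤ j →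
      eLpNorm (fracQuotient s p (fun x => f i x - f j x)) (ENNReal.ofReal p) volume < ε := by
    intro ε hε
    obtain ⟨t, ht0, htε⟩ := ENNReal.lt_iff_exists_nnreal_btwn.1 hε
    have ht : 0 < (t : ℝ) := by exact_mod_cast ht0
    obtain ⟨δ, hδ, hclose⟩ := exists_gagliardoEnergy_sub_le (Ω := Ω) hs0 hs1 hp hΩ hmle
      (show 0 < (t : ℝ) ^ p by positivity)
    obtain ⟨M, hM⟩ := exists_nat_one_div_lt hδ
    have hJ : ∀ i, M ≤ i → torsionEnergy s p Ω (f i) ≤ m + δ := fun i hi => by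
      have : 1 / ((i : ℝ) + 1) ≤ 1 / ((M : ℝ) + 1) :=
        one_div_le_one_div_of_le (by positivity) (by exact_mod_cast Nat.succ_le_succ hi)
      linarith [hfJ i]
    refine ⟨M, fun i j hi hj => ?_⟩
    have hd := (hf i).sub hs0 hp.le hΩ (hf j)
    have h1 := hclose _ _ (hf i) (hf j) (hJ i hi) (hJ j hj)
    rw [hd.gagliardoEnergy_eq hs0 hs1 hp0,
      Real.rpow_le_rpow_iff ENNReal.toReal_nonneg ht.le hp0] at h1
    refine lt_of_le_of_lt ?_ htε
    rw [← ENNReal.ofReal_toReal (hd.memLp_fracQuotient hs0 hs1 hp0).eLpNorm_lt_top.ne]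
    exact ENNReal.ofReal_le_of_le_toReal (by simpa using h1)
  obtain ⟨φ, hφ, hlim⟩ := exists_memW0_tendsto_of_cauchy hs0 hp.le hΩ hf hcauchy
  refine ⟨φ, hφ, fun u hu => le_trans ?_ (hmle u hu)⟩
  have hJlim : Filter.Tendsto (fun n => torsionEnergy s p Ω (f n)) Filter.atTop
      (nhds (torsionEnergy s p Ω φ)) :=
    ((tendsto_gagliardoEnergy hs0 hs1 hp.le hf hφ hlim).div_const p).sub
      (tendsto_integral_of_fracQuotient hs0 hs1 hp.le hΩ hf hφ hlim).1
  have hup : Filter.Tendsto (fun n : ℕ => m + 1 / ((n : ℝ) + 1)) Filter.atTop (nhds m) := by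
    simpa using tendsto_one_div_add_atTop_nhds_zero_nat.const_add m
  exact le_of_tendsto_of_tendsto' hJlim hup fun n => (hfJ n).le

end Energy

/-! ### The Euler–Lagrange equation -/

section Derivative

variable {α : Type*} [MeasurableSpace α] {μ : Measure α} {p : ℝ} {f g : α → ℝ}

theorem integrable_abs_add_abs_rpow (hp : 0 < p) (hf : MemLp f (ENNReal.ofReal p) μ)
    (hg : MemLp g (ENNReal.ofReal p) μ) : Integrable (fun x => (|f x| + |g x|) ^ p) μ := by
  refine ((hf.abs.add hg.abs).integrable_abs_rpow hp).congr
    (Filter.Eventually.of_forall fun x => ?_)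
  simp only [Pi.add_apply, Pi.abs_apply]
  rw [abs_of_nonneg (by positivity)]

theorem aestronglyMeasurable_abs_rpow_mul (q : ℝ) (hf : AEStronglyMeasurable f μ)
    (hg : AEStronglyMeasurable g μ) :
    AEStronglyMeasurable (fun x => |f x| ^ q * f x * g x) μ := by
  have h1 := hf.aemeasurable
  have h2 := hg.aemeasurable
  have h3 : AEMeasurable (fun x => |f x|) μ := h1.abs
  exact (((h3.pow_const q).mul h1).mul h2).aestronglyMeasurable

theorem integrable_abs_rpow_sub_two_mul (hp : 1 < p) (hf : MemLp f (ENNReal.ofReal p) μ)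
    (hg : MemLp g (ENNReal.ofReal p) μ) :
    Integrable (fun x => |f x| ^ (p - 2) * f x * g x) μ := by
  refine (integrable_abs_add_abs_rpow (by linarith) hf hg).mono'
    (aestronglyMeasurable_abs_rpow_mul _ hf.1 hg.1) (Filter.Eventually.of_forall fun x => ?_)
  exact abs_rpow_sub_two_mul_self_mul_le hp (le_add_of_nonneg_right (abs_nonneg _))
    (le_add_of_nonneg_left (abs_nonneg _))

/-- The directional derivative of `f ↦ ∫ |f| ^ p` on `L^p`. -/
theorem hasDerivAt_integral_abs_add_mul_rpow (hp : 1 < p) (hf : MemLp f (ENNReal.ofReal p) μ)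
    (hg : MemLp g (ENNReal.ofReal p) μ) :
    HasDerivAt (fun t : ℝ => ∫ x, |f x + t * g x| ^ p ∂μ)
      (p * ∫ x, |f x| ^ (p - 2) * f x * g x ∂μ) 0 := by
  have hp0 : 0 < p := by linarith
  have hft : ∀ t : ℝ, MemLp (fun x => f x + t * g x) (ENNReal.ofReal p) μ := fun t =>
    hf.add (hg.const_mul t)
  -- Differentiation under the integral: for `|t| < 1` both `|f + t g|` and `|g|` are at most `|f| +
  -- |g|`.
  have key := hasDerivAt_integral_of_dominated_loc_of_deriv_le (μ := μ) (𝕜 := ℝ) (x₀ := (0 : ℝ))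
    (s := Metric.ball 0 1) (bound := fun x => p * (|f x| + |g x|) ^ p)
    (F := fun t x => |f x + t * g x| ^ p)
    (F' := fun t x => p * (|f x + t * g x| ^ (p - 2) * (f x + t * g x) * g x))
    (Metric.ball_mem_nhds 0 one_pos)
    (Filter.Eventually.of_forall fun t => ((hft t).integrable_abs_rpow hp0).1)
    ((hft 0).integrable_abs_rpow hp0)
    ((aestronglyMeasurable_abs_rpow_mul _ (hft 0).1 hg.1).const_mul p)
    (Filter.Eventually.of_forall fun x t ht => ?_)
    ((integrable_abs_add_abs_rpow hp0 hf hg).const_mul p)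
    (Filter.Eventually.of_forall fun x t _ => ?_)
  · have := key.2
    simp only [zero_mul, add_zero] at this
    rwa [integral_const_mul] at this
  · have ht1 : |t| < 1 := by simpa using ht
    rw [Real.norm_eq_abs, abs_mul, abs_of_pos hp0]
    refine mul_le_mul_of_nonneg_left (abs_rpow_sub_two_mul_self_mul_le hp ?_
      (le_add_of_nonneg_left (abs_nonneg _))) hp0.le
    refine (abs_add_le _ _).trans ?_
    rw [abs_mul]
    have := mul_le_of_le_one_left (abs_nonneg (g x)) ht1.le
    linarith
  · have h1 : HasDerivAt (fun t : ℝ => f x + t * g x) (g x) t := by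
      simpa using ((hasDerivAt_id t).mul_const (g x)).const_add (f x)
    have h2 := (hasDerivAt_abs_rpow (f x + t * g x) hp).comp t h1
    exact h2.congr_deriv (by ring)

end Derivative

/-! ### Smoothed absolute values, and torsion functions as energy minimizers -/

section Torsion

variable {N : ℕ} {s p : ℝ} {Ω : Set (EuclideanSpace ℝ (Fin N))}
  {φ v : EuclideanSpace ℝ (Fin N) → ℝ}

local notation "𝔼" => EuclideanSpace ℝ (Fin N)

/-- Reverse triangle inequality for the plane vectors `(a, δ)` and `(b, δ)`; after squaring it is
Cauchy–Schwarz. It ensures that smoothing `|η|` does not increase the Gagliardo energy. -/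
theorem abs_sqrt_sq_add_sq_sub_le (a b δ : ℝ) :
    |√(a ^ 2 + δ ^ 2) - √(b ^ 2 + δ ^ 2)| ≤ |a - b| := by
  rw [← sq_le_sq]
  have ha := Real.sq_sqrt (show 0 ≤ a ^ 2 + δ ^ 2 by positivity)
  have hb := Real.sq_sqrt (show 0 ≤ b ^ 2 + δ ^ 2 by positivity)
  have hab : a * b + δ ^ 2 ≤ √(a ^ 2 + δ ^ 2) * √(b ^ 2 + δ ^ 2) := by
    rw [← Real.sqrt_mul (by positivity)]
    exact Real.le_sqrt_of_sq_le (by nlinarith [sq_nonneg (δ * (a - b))])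
  nlinarith

/-- The root is smooth because `δ > 0` keeps its argument positive; subtracting `δ` makes the
composition vanish wherever `η` does, so the support does not grow. -/
theorem IsTestFunction.sqrt_sq_add_sq_sub {η : 𝔼 → ℝ} (hη : IsTestFunction Ω η) {δ : ℝ}
    (hδ : 0 < δ) : IsTestFunction Ω (fun x => √(η x ^ 2 + δ ^ 2) - δ) := by
  have h0 : √((0 : ℝ) ^ 2 + δ ^ 2) - δ = 0 := by
    rw [zero_pow two_ne_zero, zero_add, Real.sqrt_sq hδ.le, sub_self]
  refine ⟨?_, hη.2.1.comp_left (g := fun t : ℝ => √(t ^ 2 + δ ^ 2) - δ) h0,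
    (tsupport_comp_subset (g := fun t : ℝ => √(t ^ 2 + δ ^ 2) - δ) h0 η).trans hη.2.2⟩
  exact (((hη.1.pow 2).add contDiff_const).sqrt fun x => by positivity).sub contDiff_const

theorem IsTorsionFunction.gagliardoEnergy_eq (hp : 1 < p) (hφ : IsTorsionFunction s p Ω φ) :
    gagliardoEnergy s p φ = ∫ x in Ω, φ x := by
  have h := hφ.2 φ hφ.1
  rw [fracPLaplacePairing_eq (by linarith)] at h
  simp only [one_mul] at h
  rw [← h, gagliardoEnergy]
  refine integral_congr_ae (Filter.Eventually.of_forall fun z => ?_)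
  simp only
  rcases eq_or_ne (fracQuotient s p φ z) 0 with h0 | h0
  · simp [h0, Real.zero_rpow (by linarith : p ≠ 0)]
  · have := abs_pos.2 h0
    rw [mul_assoc, ← abs_mul_abs_self, ← mul_assoc, ← Real.rpow_add_one this.ne',
      ← Real.rpow_add_one this.ne']
    congr 1; ring

theorem exists_isTestFunction_integral_pos (hΩ : IsOpen Ω) (hne : Ω.Nonempty) :
    ∃ η : 𝔼 → ℝ, IsTestFunction Ω η ∧ 0 < ∫ x in Ω, η x := by
  obtain ⟨x, hx⟩ := hne
  obtain ⟨r, hr, hball⟩ := Metric.nhds_basis_closedBall.mem_iff.1 (hΩ.mem_nhds hx)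
  let b : ContDiffBump x := ⟨r / 2, r, by positivity, by linarith⟩
  have hsupp : tsupport b ⊆ Ω := b.tsupport_eq.trans_subset hball
  refine ⟨b, ⟨b.contDiff, b.hasCompactSupport, hsupp⟩, ?_⟩
  rw [setIntegral_eq_integral_of_forall_compl_eq_zero fun y hy =>
    image_eq_zero_of_notMem_tsupport fun h => hy (hsupp h)]
  exact b.integral_pos

variable [NeZero N]

/-- The derivative at `t = 0` of the energy of `φ + t v` is the pairing minus `∫_Ω v`, and it
vanishes at a minimum. -/
theorem isTorsionFunction_of_minimizer (hs0 : 0 < s) (hs1 : s < 1) (hp : 1 < p)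
    (hΩ : Bornology.IsBounded Ω) (hφ : MemW0 s p Ω φ)
    (hmin : ∀ u : 𝔼 → ℝ, MemW0 s p Ω u → torsionEnergy s p Ω φ ≤ torsionEnergy s p Ω u) :
    IsTorsionFunction s p Ω φ := by
  have hp0 : 0 < p := by linarith
  refine ⟨hφ, fun v hv => ?_⟩
  have hd := hasDerivAt_integral_abs_add_mul_rpow hp (hφ.memLp_fracQuotient hs0 hs1 hp0)
    (hv.memLp_fracQuotient hs0 hs1 hp0)
  have hφi := hφ.integrableOn hs0 hs1 hp.le hΩ
  have hvi := hv.integrableOn hs0 hs1 hp.le hΩ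
  have hJ : ∀ t : ℝ, torsionEnergy s p Ω (fun x => φ x + t * v x) =
      (∫ z, |fracQuotient s p φ z + t * fracQuotient s p v z| ^ p) / p -
        ((∫ x in Ω, φ x) + t * ∫ x in Ω, v x) := fun t => by
    rw [torsionEnergy, gagliardoEnergy, fracQuotient_add, fracQuotient_const_mul,
      integral_add hφi (hvi.const_mul t), integral_const_mul]
  have hder : HasDerivAt (fun t : ℝ => torsionEnergy s p Ω (fun x => φ x + t * v x))
      (fracPLaplacePairing s p φ v - ∫ x in Ω, v x) 0 := by
    simp only [hJ]
    have h1 := (hd.div_const p).sub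
      (((hasDerivAt_id (0 : ℝ)).mul_const (∫ x in Ω, v x)).const_add (∫ x in Ω, φ x))
    refine h1.congr_deriv ?_
    rw [fracPLaplacePairing_eq hp0]
    field_simp
  have hloc : IsLocalMin (fun t : ℝ => torsionEnergy s p Ω (fun x => φ x + t * v x)) 0 :=
    Filter.Eventually.of_forall fun t => by
      simpa using hmin _ (hφ.add hs0 hp.le hΩ (hv.const_mul hs0 hp.le hΩ t))
  have := hloc.hasDerivAt_eq_zero hder
  simp only [one_mul]
  linarith

/-- The excess of the torsion energy over that of the torsion function is the integral of a
pointwise convexity defect. -/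
theorem IsTorsionFunction.integral_defect (hs0 : 0 < s) (hs1 : s < 1) (hp : 1 < p)
    (hΩ : Bornology.IsBounded Ω) (hφ : IsTorsionFunction s p Ω φ) (hv : MemW0 s p Ω v) :
    Integrable (fun z => |fracQuotient s p v z| ^ p - (|fracQuotient s p φ z| ^ p +
      p * (|fracQuotient s p φ z| ^ (p - 2) * fracQuotient s p φ z *
        (fracQuotient s p v z - fracQuotient s p φ z)))) volume ∧
    ∫ z, (|fracQuotient s p v z| ^ p - (|fracQuotient s p φ z| ^ p +
      p * (|fracQuotient s p φ z| ^ (p - 2) * fracQuotient s p φ z *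
        (fracQuotient s p v z - fracQuotient s p φ z)))) =
      p * (torsionEnergy s p Ω v - torsionEnergy s p Ω φ) := by
  have hp0 : 0 < p := by linarith
  have hd := hv.sub hs0 hp.le hΩ hφ.1
  have h1 := hv.integrable_abs_fracQuotient_rpow hs0 hs1 hp0
  have h2 := hφ.1.integrable_abs_fracQuotient_rpow hs0 hs1 hp0
  have h3 := integrable_abs_rpow_sub_two_mul hp (hφ.1.memLp_fracQuotient hs0 hs1 hp0)
    (hd.memLp_fracQuotient hs0 hs1 hp0)
  -- Testing with `v - φ` turns the first-order term of the defect into `∫_Ω v - ∫_Ω φ`.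
  have hpair := hφ.2 _ hd
  rw [fracPLaplacePairing_eq hp0] at hpair
  simp only [one_mul] at hpair
  rw [integral_sub (hv.integrableOn hs0 hs1 hp.le hΩ) (hφ.1.integrableOn hs0 hs1 hp.le hΩ)]
    at hpair
  rw [fracQuotient_sub] at h3 hpair
  have h4 : Integrable (fun z => |fracQuotient s p φ z| ^ p +
      p * (|fracQuotient s p φ z| ^ (p - 2) * fracQuotient s p φ z *
        (fracQuotient s p v z - fracQuotient s p φ z))) volume := h2.add (h3.const_mul p)
  refine ⟨h1.sub h4, ?_⟩
  rw [integral_sub h1 h4, integral_add h2 (h3.const_mul p), integral_const_mul, hpair]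
  simp only [torsionEnergy, gagliardoEnergy]
  field_simp
  ring

theorem IsTorsionFunction.torsionEnergy_le (hs0 : 0 < s) (hs1 : s < 1) (hp : 1 < p)
    (hΩ : Bornology.IsBounded Ω) (hφ : IsTorsionFunction s p Ω φ) (hv : MemW0 s p Ω v) :
    torsionEnergy s p Ω φ ≤ torsionEnergy s p Ω v := by
  have h := (hφ.integral_defect hs0 hs1 hp hΩ hv).2
  have h0 := h ▸ integral_nonneg fun z => sub_nonneg.2 (abs_rpow_tangent_le hp
    (fracQuotient s p φ z) (fracQuotient s p v z))
  have := nonneg_of_mul_nonneg_right h0 (by linarith : 0 < p)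
  linarith

/-- The torsion function is the only minimizer of the torsion energy. -/
theorem IsTorsionFunction.ae_eq_of_torsionEnergy_le (hs0 : 0 < s) (hs1 : s < 1) (hp : 1 < p)
    (hΩ : Bornology.IsBounded Ω) (hφ : IsTorsionFunction s p Ω φ) (hv : MemW0 s p Ω v)
    (hle : torsionEnergy s p Ω v ≤ torsionEnergy s p Ω φ) : v =ᵐ[volume] φ := by
  have hp0 : 0 < p := by linarith
  obtain ⟨hi, h⟩ := hφ.integral_defect hs0 hs1 hp hΩ hv
  rw [le_antisymm hle (hφ.torsionEnergy_le hs0 hs1 hp hΩ hv), sub_self, mul_zero,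
    integral_eq_zero_iff_of_nonneg (fun z => sub_nonneg.2 (abs_rpow_tangent_le hp
    (fracQuotient s p φ z) (fracQuotient s p v z))) hi] at h
  -- The nonnegative defect has integral zero, so strictness of the tangent inequality forces the
  -- two difference quotients to agree almost everywhere; Poincaré then identifies the functions.
  have hzero : fracQuotient s p (fun x => v x - φ x) =ᵐ[volume] 0 := by
    filter_upwards [h] with z hz
    simp only [fracQuotient_sub, Pi.zero_apply]
    by_contra hne
    have := abs_rpow_tangent_lt hp (fun h => hne (by rw [h, sub_self]) :
      fracQuotient s p φ z ≠ fracQuotient s p v z)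
    simp only [Pi.zero_apply] at hz
    linarith
  filter_upwards [(hv.sub hs0 hp.le hΩ hφ.1).ae_eq_zero_of_fracQuotient hs0 hp0 hΩ hzero] with x hx
  exact sub_eq_zero.1 hx

/-! ### Comparison with absolute values -/

theorem gagliardoEnergy_le_of_abs_sub_le (hs0 : 0 < s) (hs1 : s < 1) (hp : 0 < p)
    {u v : 𝔼 → ℝ} (hu : MemW0 s p Ω u) (hv : MemW0 s p Ω v)
    (h : ∀ x y, |u x - u y| ≤ |v x - v y|) : gagliardoEnergy s p u ≤ gagliardoEnergy s p v := by
  refine integral_mono (hu.integrable_abs_fracQuotient_rpow hs0 hs1 hp)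
    (hv.integrable_abs_fracQuotient_rpow hs0 hs1 hp) fun z => ?_
  simp only [abs_fracQuotient_rpow hp]
  exact div_le_div_of_nonneg_right (Real.rpow_le_rpow (abs_nonneg _) (h _ _) hp.le)
    (by positivity)

/-- The torsion energy of `φ` is also a lower bound for the energies in which the integral of `v` is
replaced with that of `|v|`. -/
theorem IsTorsionFunction.torsionEnergy_le_abs (hs0 : 0 < s) (hs1 : s < 1) (hp : 1 < p)
    (hΩ : Bornology.IsBounded Ω) (hφ : IsTorsionFunction s p Ω φ) (hv : MemW0 s p Ω v) :
    torsionEnergy s p Ω φ ≤ gagliardoEnergy s p v / p - ∫ x in Ω, |v x| := by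
  have hp0 : 0 < p := by linarith
  have hvol : volume Ω ≠ ⊤ := hΩ.measure_lt_top.ne
  -- For a test function, `√(η² + δ²) - δ` is an admissible competitor with no more seminorm energy
  -- than `η`, and its integral falls short of that of `|η|` by at most `δ |Ω|`.
  have htest : ∀ η : 𝔼 → ℝ, IsTestFunction Ω η →
      torsionEnergy s p Ω φ ≤ gagliardoEnergy s p η / p - ∫ x in Ω, |η x| := by
    intro η hη
    have hηi := (hη.memW0 (s := s) hp0).integrableOn hs0 hs1 hp.le hΩ
    have hδ : ∀ δ : ℝ, 0 < δ → torsionEnergy s p Ω φ ≤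
        gagliardoEnergy s p η / p - (∫ x in Ω, |η x|) + δ * volume.real Ω := by
      intro δ hδ
      have ht := (hη.sqrt_sq_add_sq_sub hδ).memW0 (s := s) hp0
      have h1 := hφ.torsionEnergy_le hs0 hs1 hp hΩ ht
      have h2 := gagliardoEnergy_le_of_abs_sub_le hs0 hs1 hp0 ht (hη.memW0 hp0) fun x y => by
        simpa using abs_sqrt_sq_add_sq_sub_le (η x) (η y) δ
      have h3 : (∫ x in Ω, |η x|) - δ * volume.real Ω ≤ ∫ x in Ω, (√(η x ^ 2 + δ ^ 2) - δ) := by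
        have hc : IntegrableOn (fun _ : 𝔼 => δ) Ω := integrableOn_const hvol
        have : ∫ x in Ω, (|η x| - δ) = (∫ x in Ω, |η x|) - δ * volume.real Ω := by
          rw [integral_sub hηi.abs hc, setIntegral_const, smul_eq_mul, mul_comm]
        rw [← this]
        refine integral_mono (hηi.abs.sub hc) (ht.integrableOn hs0 hs1 hp.le hΩ) fun x => ?_
        have : |η x| ≤ √(η x ^ 2 + δ ^ 2) := Real.abs_le_sqrt (by nlinarith [sq_nonneg δ])
        simp only
        linarith
      rw [torsionEnergy.eq_1 s p Ω (fun x => √(η x ^ 2 + δ ^ 2) - δ)] at h1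
      have h4 := div_le_div_of_nonneg_right h2 hp0.le
      linarith
    have hlim : Filter.Tendsto (fun δ : ℝ => gagliardoEnergy s p η / p - (∫ x in Ω, |η x|) +
        δ * volume.real Ω) (nhdsWithin 0 (Ioi 0))
        (nhds (gagliardoEnergy s p η / p - ∫ x in Ω, |η x|)) := by
      have : Continuous fun δ : ℝ => gagliardoEnergy s p η / p - (∫ x in Ω, |η x|) +
        δ * volume.real Ω := by fun_prop
      simpa using (this.tendsto 0).mono_left nhdsWithin_le_nhds
    exact ge_of_tendsto hlim (Filter.eventually_of_mem self_mem_nhdsWithin hδ)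
  -- Both sides of the inequality are continuous for the seminorm, so it extends from test functions
  -- to their closure.
  have happrox : ∀ n : ℕ, ∃ η : 𝔼 → ℝ, IsTestFunction Ω η ∧
      eLpNorm (fracQuotient s p (fun x => v x - η x)) (ENNReal.ofReal p) volume <
        ((n : ℝ≥0∞) + 1)⁻¹ := fun n =>
    hv.exists_testFunction hp0 (by simp)
  choose η hη hηlt using happrox
  have hlim : Filter.Tendsto
      (fun n => eLpNorm (fracQuotient s p (fun x => η n x - v x)) (ENNReal.ofReal p) volume)
      Filter.atTop (nhds 0) := by
    have h0 : Filter.Tendsto (fun n : ℕ => ((n : ℝ≥0∞) + 1)⁻¹) Filter.atTop (nhds 0) := by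
      have := ENNReal.tendsto_inv_nat_nhds_zero.comp (Filter.tendsto_add_atTop_nat 1)
      refine this.congr fun n => ?_
      simp
    refine tendsto_of_tendsto_of_tendsto_of_le_of_le tendsto_const_nhds h0
      (fun _ => zero_le) fun n => ?_
    rw [eLpNorm_fracQuotient_sub_comm]
    exact (hηlt n).le
  have hηW := fun n => (hη n).memW0 (s := s) hp0
  exact ge_of_tendsto' (((tendsto_gagliardoEnergy hs0 hs1 hp.le hηW hv hlim).div_const p).sub
    (tendsto_integral_of_fracQuotient hs0 hs1 hp.le hΩ hηW hv hlim).2) fun n => htest _ (hη n)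

/-! ### Properties of the torsion function -/

/-- Comparing `φ` with itself in `IsTorsionFunction.torsionEnergy_le_abs` cancels the energies and
leaves `∫ |φ| ≤ ∫ φ`. -/
theorem IsTorsionFunction.integral_abs_eq (hs0 : 0 < s) (hs1 : s < 1) (hp : 1 < p)
    (hΩ : Bornology.IsBounded Ω) (hφ : IsTorsionFunction s p Ω φ) :
    ∫ x in Ω, |φ x| = ∫ x in Ω, φ x := by
  refine le_antisymm ?_ ((le_abs_self _).trans abs_integral_le_integral_abs)
  have := hφ.torsionEnergy_le_abs hs0 hs1 hp hΩ hφ.1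
  rw [torsionEnergy] at this
  linarith

theorem IsTorsionFunction.ae_nonneg (hs0 : 0 < s) (hs1 : s < 1) (hp : 1 < p)
    (hΩ : Bornology.IsBounded Ω) (hΩm : MeasurableSet Ω) (hφ : IsTorsionFunction s p Ω φ) :
    ∀ᵐ x ∂volume, 0 ≤ φ x := by
  have hi := hφ.1.integrableOn hs0 hs1 hp.le hΩ
  have h : ∫ x in Ω, (|φ x| - φ x) = 0 := by
    rw [integral_sub hi.abs hi, hφ.integral_abs_eq hs0 hs1 hp hΩ, sub_self]
  rw [integral_eq_zero_iff_of_nonneg (fun x => sub_nonneg.2 (le_abs_self _)) (hi.abs.sub hi)] at h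
  have h' := (ae_restrict_iff' hΩm).1 h
  filter_upwards [h', hφ.1.ae_eq_zero] with x h1 h2
  by_cases hx : x ∈ Ω
  · have := h1 hx
    simp only [Pi.zero_apply] at this
    linarith [abs_nonneg (φ x)]
  · exact (h2 hx).ge

/-- The integral equals the energy of `φ`. Were it zero, the difference quotient of `φ` would
vanish, and the equation would fail for a bump function of positive integral. -/
theorem IsTorsionFunction.integral_pos (hs0 : 0 < s) (hs1 : s < 1) (hp : 1 < p)
    (hΩ : IsOpen Ω) (hne : Ω.Nonempty) (hφ : IsTorsionFunction s p Ω φ) :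
    0 < ∫ x in Ω, φ x := by
  have hp0 : 0 < p := by linarith
  rw [← hφ.gagliardoEnergy_eq hp]
  refine (gagliardoEnergy_nonneg s p φ).lt_of_ne' fun h => ?_
  rw [gagliardoEnergy, integral_eq_zero_iff_of_nonneg (fun _ => by positivity)
    (hφ.1.integrable_abs_fracQuotient_rpow hs0 hs1 hp0)] at h
  obtain ⟨η, hη, hpos⟩ := exists_isTestFunction_integral_pos hΩ hne
  have hpair := hφ.2 η (hη.memW0 hp0)
  simp only [one_mul] at hpair
  rw [← hpair, fracPLaplacePairing_eq hp0, integral_eq_zero_of_ae] at hpos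
  · exact lt_irrefl _ hpos
  filter_upwards [h] with z hz
  have : fracQuotient s p φ z = 0 := by
    simpa using (Real.rpow_eq_zero (abs_nonneg _) hp0.ne').1 hz
  simp [this]

theorem MemW0.normL_one_eq (hs0 : 0 < s) (hs1 : s < 1) (hp : 1 ≤ p)
    (hΩ : Bornology.IsBounded Ω) (hv : MemW0 s p Ω v) :
    normL 1 Ω v = ENNReal.ofReal (∫ x in Ω, |v x|) := by
  rw [normL, ENNReal.ofReal_one, eLpNorm_one_eq_lintegral_enorm]
  exact (ofReal_integral_norm_eq_lintegral_enorm (hv.integrableOn hs0 hs1 hp hΩ)).symm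

end Torsion

/-! ### The torsion function and the constrained minimum -/

theorem mainTheorem2 (N : ℕ) (hN : 2 ≤ N) (Ω : Set (EuclideanSpace ℝ (Fin N)))
    (hΩ : IsBoundedLipschitzDomain Ω) (s p : ℝ) (hs0 : 0 < s) (hs1 : s < 1) (hp : 1 < p)
    (hpN : p < (N : ℝ) / s) :
    -- the torsion function exists and is unique
    (∃ φ : EuclideanSpace ℝ (Fin N) → ℝ, IsTorsionFunction s p Ω φ ∧
      ∀ ψ : EuclideanSpace ℝ (Fin N) → ℝ, IsTorsionFunction s p Ω ψ → ψ =ᵐ[volume] φ) ∧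
    ∀ φ : EuclideanSpace ℝ (Fin N) → ℝ, IsTorsionFunction s p Ω φ →
      -- it is nonnegative, with `0 < |φ|_1 < ∞`
      (∀ᵐ x ∂volume, 0 ≤ φ x) ∧ 0 < normL 1 Ω φ ∧ normL 1 Ω φ < ⊤ ∧
      -- the minimum is `1 / |φ|_1 ^ (p - 1)`
      IsLeast {t : ℝ≥0∞ | ∃ v : EuclideanSpace ℝ (Fin N) → ℝ,
          MemW0 s p Ω v ∧ normL 1 Ω v = 1 ∧ t = gagliardoSeminorm s p v ^ p}
        (1 / normL 1 Ω φ ^ (p - 1)) ∧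
      -- it is attained at `φ / |φ|_1`
      (MemW0 s p Ω (normalizeL1 Ω φ) ∧ normL 1 Ω (normalizeL1 Ω φ) = 1 ∧
        gagliardoSeminorm s p (normalizeL1 Ω φ) ^ p = 1 / normL 1 Ω φ ^ (p - 1)) ∧
      -- and at no other nonnegative function
      ∀ v : EuclideanSpace ℝ (Fin N) → ℝ, MemW0 s p Ω v → normL 1 Ω v = 1 →
        (∀ᵐ x ∂volume, 0 ≤ v x) →
        gagliardoSeminorm s p v ^ p = 1 / normL 1 Ω φ ^ (p - 1) →
        v =ᵐ[volume] normalizeL1 Ω φ := by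
  have : NeZero N := ⟨by omega⟩
  have hp0 : 0 < p := by linarith
  have hb := hΩ.isBounded
  refine ⟨?_, fun φ hφ => ?_⟩
  · obtain ⟨φ, hφ, hmin⟩ := exists_minimizer (Ω := Ω) hs0 hs1 hp hb
    have htor := isTorsionFunction_of_minimizer hs0 hs1 hp hb hφ hmin
    -- Any other weak solution `ψ` also minimizes the energy, so uniqueness of the minimizer
    -- applies.
    exact ⟨φ, htor, fun ψ hψ => htor.ae_eq_of_torsionEnergy_le hs0 hs1 hp hb hψ.1
      (hψ.torsionEnergy_le hs0 hs1 hp hb hφ)⟩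
  have hnonneg := hφ.ae_nonneg hs0 hs1 hp hb hΩ.isOpen.measurableSet
  set A := ∫ x in Ω, φ x with hA
  have hApos : 0 < A := hφ.integral_pos hs0 hs1 hp hΩ.isOpen hΩ.isConnected.nonempty
  have hGφ : gagliardoEnergy s p φ = A := hφ.gagliardoEnergy_eq hp
  have hnorm : normL 1 Ω φ = ENNReal.ofReal A := by
    rw [hφ.1.normL_one_eq hs0 hs1 hp.le hb, hφ.integral_abs_eq hs0 hs1 hp hb]
  have hpow : A ^ p = A ^ (p - 1) * A := by
    rw [← Real.rpow_add_one hApos.ne']; congr 1; ring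
  have hA1 : 0 < A ^ (p - 1) := by positivity
  have hvalue : 1 / normL 1 Ω φ ^ (p - 1) = ENNReal.ofReal (1 / A ^ (p - 1)) := by
    rw [hnorm, ENNReal.ofReal_rpow_of_pos hApos, ENNReal.ofReal_div_of_pos hA1, ENNReal.ofReal_one]
  have hnormalize : normalizeL1 Ω φ = fun x => A⁻¹ * φ x := by
    ext x
    rw [normalizeL1, hnorm, ENNReal.toReal_ofReal hApos.le, div_eq_inv_mul]
  have hJφ : torsionEnergy s p Ω φ = A / p - A := by rw [torsionEnergy, hGφ]
  have hone : ∀ v, MemW0 s p Ω v → normL 1 Ω v = 1 → ∫ x in Ω, |v x| = 1 := fun v hv h => by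
    rw [hv.normL_one_eq hs0 hs1 hp.le hb, ENNReal.ofReal_eq_one] at h
    exact h
  have hattain : MemW0 s p Ω (normalizeL1 Ω φ) ∧ normL 1 Ω (normalizeL1 Ω φ) = 1 ∧
      gagliardoSeminorm s p (normalizeL1 Ω φ) ^ p = 1 / normL 1 Ω φ ^ (p - 1) := by
    have hmem : MemW0 s p Ω (normalizeL1 Ω φ) := by
      rw [hnormalize]
      exact hφ.1.const_mul hs0 hp.le hb _
    refine ⟨hmem, ?_, ?_⟩
    · rw [hmem.normL_one_eq hs0 hs1 hp.le hb, hnormalize]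
      simp only [abs_mul]
      rw [integral_const_mul, hφ.integral_abs_eq hs0 hs1 hp hb, ← hA,
        abs_of_pos (inv_pos.2 hApos), inv_mul_cancel₀ hApos.ne', ENNReal.ofReal_one]
    · rw [hmem.gagliardoSeminorm_rpow hs0 hs1 hp0, hvalue, hnormalize, gagliardoEnergy_const_mul,
        hGφ, abs_of_pos (inv_pos.2 hApos), Real.inv_rpow hApos.le, hpow]
      congr 1
      field_simp
  refine ⟨hnonneg, ?_, ?_, ⟨⟨_, hattain.1, hattain.2.1, hattain.2.2.symm⟩, ?_⟩, hattain, ?_⟩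
  · rw [hnorm]; exact ENNReal.ofReal_pos.2 hApos
  · rw [hnorm]; exact ENNReal.ofReal_lt_top
  · rintro t ⟨v, hv, hv1, rfl⟩
    rw [hvalue, hv.gagliardoSeminorm_rpow hs0 hs1 hp0]
    refine ENNReal.ofReal_le_ofReal ?_
    -- The multiple `A v` has the same `L^1` norm as `φ`, so the linear terms `-A` cancel and `A / p
    -- ≤ A^p [v]^p / p` remains.
    have h := hφ.torsionEnergy_le_abs hs0 hs1 hp hb (hv.const_mul hs0 hp.le hb A)
    simp only [abs_mul] at h
    rw [hJφ, gagliardoEnergy_const_mul, integral_const_mul, hone v hv hv1, abs_of_pos hApos,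
      mul_one, sub_le_sub_iff_right, div_le_div_iff_of_pos_right hp0, hpow] at h
    rw [div_le_iff₀ hA1]
    refine le_of_mul_le_mul_right ?_ hApos
    linarith
  · intro v hv hv1 hv0 hGv
    have hGv' : gagliardoEnergy s p v = 1 / A ^ (p - 1) := by
      rw [hvalue, hv.gagliardoSeminorm_rpow hs0 hs1 hp0,
        ENNReal.ofReal_eq_ofReal_iff (gagliardoEnergy_nonneg _ _ _) (by positivity)] at hGv
      exact hGv
    have hint : ∫ x in Ω, v x = 1 := by
      rw [← hone v hv hv1]
      refine integral_congr_ae (ae_restrict_of_ae ?_)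
      filter_upwards [hv0] with x hx
      exact (abs_of_nonneg hx).symm
    -- Because `v ≥ 0`, its integral is its `L^1` norm, so `A v` has exactly the minimal energy `A /
    -- p - A` and coincides with `φ`.
    have hJ : torsionEnergy s p Ω (fun x => A * v x) = torsionEnergy s p Ω φ := by
      rw [hJφ, torsionEnergy, gagliardoEnergy_const_mul, integral_const_mul, hint, hGv',
        abs_of_pos hApos, hpow, mul_one]
      field_simp
    filter_upwards [hφ.ae_eq_of_torsionEnergy_le hs0 hs1 hp hb (hv.const_mul hs0 hp.le hb A)
      hJ.le] with x hx
    simp only [hnormalize]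
    rw [← hx, inv_mul_cancel_left₀ hApos.ne']
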